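/- Let $f_i,g_i\in\mathbb{C}[x_1,\dots,x_m,z]$ $(i=1,\dots,m)$ and consider the system $$\frac{dx_i}{dz}=f_i(x_1,\dots,x_m,z)+g_i(x_1,\dots,x_m,z),\qquad i=1,\dots,m. \tag{1}$$ Assume that there are positive integers $p_1,\dots,p_m,r$ (where $r=0$ is also allowed if $f_1,\dots,f_m$ do not depend on $z$) such that (A1) $f_i(\lambda^{p_1}x_1,\dots,\lambda^{p_m}x_m,\lambda^r z)=\lambda^{p_i+1}f_i(x_1,\dots,x_m,z)$ for all $\lambda\in\mathbb{C}$ and all $i$; (A2) $g_i(\lambda^{p_1}x_1,\dots,\lambda^{p_m}x_m,\lambda^r z)=o(\lambda^{p_i+1})$ as $|\lambda|\to\infty$, for all $(x_1,\dots,x_m,z)\in\mathbb{C}^{m+1}$ and all $i$; (S) the truncated system $dx_i/dz=f_i^A(x):=f_i(x_1,\dots,x_m,0)$ has only the origin as a fixed point, i.e. $f_i^A(x)=0$ for all $i$ implies $x=0$. Let $z_0\in\mathbb{C}$, and let $x=(x_1,\dots,x_m)$ be a formal series solution of (1) of the form $x_i=\sum_{n\ge N_i}b_{i,n}(z-z_0)^n$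 with $N_i\in\mathbb{Z}$, where each coefficient $b_{i,n}$ is a polynomial over $\mathbb{C}$ in $\log(z-z_0)$ (formal Laurent series are the case of constant $b_{i,n}$). Suppose that $x$ has a singularity at $z_0$, i.e. some $x_i$ is not a formal power series in $z-z_0$ with constant coefficients. Then there is $c=(c_1,\dots,c_m)\in\mathbb{C}^m$, $c\neq 0$, such that for every $i$ $$x_i=c_i(z-z_0)^{-p_i}+a_{i,1}(z-z_0)^{-p_i+1}+a_{i,2}(z-z_0)^{-p_i+2}+\cdots ,$$ where the $a_{i,n}$ are polynomials in $\log(z-z_0)$. Moreover every such series converges: for every $\theta\ge 0$ there is $\varepsilon>0$ such that all the series $\sum_n b_{i,n}(z-z_0)^n$ converge absolutely whenever $0<|z-z_0|<\varepsilon$ and $\log(z-z_0)$ is given any value with $|\mathrm{Im}\,\log(z-z_0)|\le\theta$. In particular, if no logarithms occur, they converge on a punctured disc $0<|z-z_0|<\varepsilon$. -/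

import Mathlib

open scoped Polynomial

noncomputable section

/-- Polynomials over `ℂ` in the variables `x_1, …, x_m` (the variables `some i`) and `z`
(the variable `none`). -/
abbrev SysPoly (m : ℕ) : Type := MvPolynomial (Option (Fin m)) ℂ

/-- The value `P(x_1, …, x_m, z)` at a point of `ℂ^{m+1}`. -/
def SysPoly.at {m : ℕ} (P : SysPoly m) (x : Fin m → ℂ) (z : ℂ) : ℂ :=
  MvPolynomial.eval (fun o => o.elim z x) P

/-- Quasi-homogeneity of the vector field `f` with weights `p_i` (of `x_i`) and `r` (of `z`):
`f_i(λ^{p_1} x_1, …, λ^{p_m} x_m, λ^r z) = λ^{p_i+1} f_i(x_1, …, x_m, z)` for all `λ ∈ ℂ`. -/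
def QuasiHomogeneous {m : ℕ} (p : Fin m → ℕ) (r : ℕ) (f : Fin m → SysPoly m) : Prop :=
  ∀ (i : Fin m) (μ : ℂ) (x : Fin m → ℂ) (z : ℂ),
    (f i).at (fun j => μ ^ p j * x j) (μ ^ r * z) = μ ^ (p i + 1) * (f i).at x z

/-- The polynomials `f_i` do not depend on `z`. -/
def Autonomous {m : ℕ} (f : Fin m → SysPoly m) : Prop :=
  ∀ (i : Fin m) (x : Fin m → ℂ) (z z' : ℂ), (f i).at x z = (f i).at x z'

/-- The weights are admissible: all `p_i` and `r` are positive; by convention `r = 0` is also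
allowed when `f` does not depend on `z`. -/
def AdmissibleWeight {m : ℕ} (p : Fin m → ℕ) (r : ℕ) (f : Fin m → SysPoly m) : Prop :=
  (∀ i, 0 < p i) ∧ (0 < r ∨ (r = 0 ∧ Autonomous f))

/-- The perturbation `g` is small with respect to the weights:
`g_i(λ^{p_1} x_1, …, λ^{p_m} x_m, λ^r z) = o(λ^{p_i+1})` as `|λ| → ∞`. -/
def SmallPerturbation {m : ℕ} (p : Fin m → ℕ) (r : ℕ) (g : Fin m → SysPoly m) : Prop :=
  ∀ (i : Fin m) (x : Fin m → ℂ) (z : ℂ),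
    (fun μ : ℂ => (g i).at (fun j => μ ^ p j * x j) (μ ^ r * z))
      =o[Bornology.cobounded ℂ] (fun μ : ℂ => μ ^ (p i + 1))

/-- The autonomous part `f_i^A(x) = f_i(x, 0)`, the right-hand side of the truncated system. -/
def truncated {m : ℕ} (f : Fin m → SysPoly m) (x : Fin m → ℂ) : Fin m → ℂ :=
  fun i => (f i).at x 0

/-- The truncated system has no fixed point other than the origin. -/
def OnlyTrivialFixedPoint {m : ℕ} (f : Fin m → SysPoly m) : Prop :=
  ∀ x : Fin m → ℂ, truncated f x = 0 → x = 0

/-- Formal series `∑_{n ≥ N} a_n T^n` with `N ∈ ℤ`, `T = z - z_0`, whose coefficients `a_n` are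
polynomials over `ℂ` in `log T` (the polynomial variable stands for `log T`). The series without
logarithms, i.e. the formal Laurent series over `ℂ`, are those with constant `a_n`. -/
abbrev LogLaurent : Type := LaurentSeries ℂ[X]

/-- The constant series. -/
def LogLaurent.const : ℂ →+* LogLaurent :=
  (HahnSeries.C : ℂ[X] →+* LaurentSeries ℂ[X]).comp Polynomial.C

/-- The series of the function `z`, namely `z_0 + T`. -/
def LogLaurent.indep (z₀ : ℂ) : LogLaurent :=
  LogLaurent.const z₀ + HahnSeries.single (1 : ℤ) (1 : ℂ[X])

/-- The termwise derivative `d/dz`, determined by `d/dz T = 1` and `d/dz log T = T⁻¹`: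
`d/dz (a(log T) T^n) = (n a(log T) + a'(log T)) T^{n-1}`. -/
def LogLaurent.deriv (x : LogLaurent) : LogLaurent :=
  LaurentSeries.derivative ℂ x
    + HahnSeries.single (-1 : ℤ) (1 : ℂ[X]) * x.map (Polynomial.derivative (R := ℂ))

/-- The coefficients of the termwise derivative. -/
theorem LogLaurent.coeff_deriv (x : LogLaurent) (n : ℤ) :
    x.deriv.coeff n
      = (n + 1) • x.coeff (n + 1) + Polynomial.derivative (x.coeff (n + 1)) := by
  have h := HahnSeries.coeff_single_mul_add (r := (1 : ℂ[X]))
    (x := x.map (Polynomial.derivative (R := ℂ))) (a := n + 1) (b := (-1 : ℤ))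
  rw [add_neg_cancel_right] at h
  simp [LogLaurent.deriv, h, LaurentSeries.derivative_apply, LaurentSeries.hasseDeriv_coeff]

/-- Substitution of formal series for `x_1, …, x_m` and `z` into a polynomial. -/
def SysPoly.subst {m : ℕ} (P : SysPoly m) (x : Fin m → LogLaurent) (z : LogLaurent) :
    LogLaurent :=
  MvPolynomial.eval₂ LogLaurent.const (fun o => o.elim z x) P

/-- `x` is a formal series solution, in powers of `T = z - z_0` with coefficients polynomial in
`log T`, of the system `dx_i/dz = f_i(x, z) + g_i(x, z)`. -/
def IsFormalSolution {m : ℕ} (f g : Fin m → SysPoly m) (z₀ : ℂ) (x : Fin m → LogLaurent) :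
    Prop :=
  ∀ i, (x i).deriv = (f i).subst x (LogLaurent.indep z₀) + (g i).subst x (LogLaurent.indep z₀)

/-- The series is a formal power series in `T`: no negative powers of `T` and no logarithms. -/
def LogLaurent.IsRegular (x : LogLaurent) : Prop :=
  (∀ n : ℤ, n < 0 → x.coeff n = 0) ∧ (∀ n : ℤ, ∃ a : ℂ, x.coeff n = Polynomial.C a)

/-- The tuple of formal series has a singularity at `T = 0`. -/
def IsSingular {m : ℕ} (x : Fin m → LogLaurent) : Prop :=
  ∃ i, ¬ (x i).IsRegular

/-- `x_i = c_i T^{-p_i} + a_{i,1} T^{-p_i+1} + a_{i,2} T^{-p_i+2} + ⋯` for all `i`, where the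
`c_i` are complex numbers (the `a_{i,n}` may contain `log T`). -/
def HasLeadingForm {m : ℕ} (p : Fin m → ℕ) (c : Fin m → ℂ) (x : Fin m → LogLaurent) : Prop :=
  ∀ i, (∀ n : ℤ, n < -(p i : ℤ) → (x i).coeff n = 0) ∧
    (x i).coeff (-(p i : ℤ)) = Polynomial.C (c i)

/-- The series converges (absolutely) on a punctured disc `0 < |z - z_0| < ε`, for every choice of
the value `w` of `log (z - z_0)` whose imaginary part, an argument of `z - z_0`, is bounded by a
prescribed `θ`; the radius `ε` may depend on `θ`. With `θ = π` this covers the whole punctured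
disc, and in the absence of logarithms the terms do not depend on `w`. -/
def LogLaurent.Converges (z₀ : ℂ) (x : LogLaurent) : Prop :=
  ∀ θ : ℝ, ∃ ε : ℝ, 0 < ε ∧ ∀ z : ℂ, 0 < ‖z - z₀‖ → ‖z - z₀‖ < ε →
    ∀ w : ℂ, Complex.exp w = z - z₀ → |w.im| ≤ θ →
      Summable (fun n : ℤ => (x.coeff n).eval w * (z - z₀) ^ n)

end

/-! By (A1) and (A2) the monomials of `f_i` have weight exactly `p_i + 1`, those of `g_i` a smaller
one. Suppose there is a pole. Let `v > 0` be the largest ratio of pole order to `p_j`, attained at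
`k`, and let `y_j`, a polynomial in `log T`, be the coefficient of `T^{-v p_j}` in `x_j`, so that
`y_k ≠ 0`. In equation `i` the right-hand side starts at order `-v(p_i+1)` with coefficient
`f_i^A(y)`, the left-hand side at order `-v p_i - 1` with coefficient `y_i' - v p_i y_i`. If `v <
1`, the left side forces `y_k = 0`; if `v > 1`, then `f^A(y) = 0` and (S) forces `y = 0`. So `v = 1`
and `y_i' - p_i y_i = f_i^A(y)`. Comparing growth as `log T → ∞` in the same weights yields a
nonzero zero of `f^A` unless `y` is constant (`natDegree_eq_zero_of_autonomous_system`). Without a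
pole, the recursion for the coefficients never produces a logarithm, so there is no singularity.

For convergence, `x_i = T^{-p_i}(c_i + u_i)` turns the system into a Briot-Bouquet system `T u_i' =
Φ_i(u, T)` with polynomial `Φ_i`; the coefficients `a_n` of `u_i` satisfy `n a_n + a_n' = [T^n]
Φ_i(u, T)`. In the `ℓ¹`-norm with weight `R^k` on `(log T)^k`, differentiation costs a factor `deg /
R`, so it is absorbed by `n` once `R` is large. A continuity argument gives `‖a_n‖_R ≤ (B R^K)^n`.
The growth in `R` bounds the degree of `a_n` by `K n`, which makes the estimate uniform in `n`.
Taking `R` of size `|log T|`, convergence follows from `|T| |log T|^K → 0`. -/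

open scoped Polynomial

noncomputable section

/-! ### Weights of monomials -/

/-- The weight of a monomial in `x_1, …, x_m, z`, if `x_i` has weight `p_i` and `z` weight `r`. -/
def monomialWeight {m : ℕ} (p : Fin m → ℕ) (r : ℕ) (d : Option (Fin m) →₀ ℕ) : ℕ :=
  r * d none + ∑ j, p j * d (some j)

theorem SysPoly.at_eq_sum {m : ℕ} (P : SysPoly m) (x : Fin m → ℂ) (z : ℂ) :
    P.at x z = ∑ d ∈ P.support, P.coeff d * (z ^ d none * ∏ j, x j ^ d (some j)) := by
  rw [SysPoly.at, MvPolynomial.eval_eq']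
  simp [Fintype.prod_option]

theorem SysPoly.at_smul_eq_sum {m : ℕ} (P : SysPoly m) (p : Fin m → ℕ) (r : ℕ)
    (μ : ℂ) (x : Fin m → ℂ) (z : ℂ) :
    P.at (fun j => μ ^ p j * x j) (μ ^ r * z) =
      ∑ d ∈ P.support,
        P.coeff d * μ ^ monomialWeight p r d * (z ^ d none * ∏ j, x j ^ d (some j)) := by
  rw [SysPoly.at_eq_sum]
  refine Finset.sum_congr rfl fun d _ => ?_
  rw [monomialWeight, pow_add, ← Finset.prod_pow_eq_pow_sum]
  simp only [mul_pow, Finset.prod_mul_distrib, pow_mul]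
  ring

/-- A polynomial function that vanishes identically has vanishing coefficients, also after the
coefficients are multiplied by scalars `φ d`. -/
theorem SysPoly.eq_zero_of_sum_eq_zero {m : ℕ} (P : SysPoly m) (φ : (Option (Fin m) →₀ ℕ) → ℂ)
    (h : ∀ (x : Fin m → ℂ) (z : ℂ),
      ∑ d ∈ P.support, P.coeff d * φ d * (z ^ d none * ∏ j, x j ^ d (some j)) = 0)
    {d : Option (Fin m) →₀ ℕ} (hd : d ∈ P.support) : φ d = 0 := by
  classical
  have key : (∑ e ∈ P.support, MvPolynomial.monomial e (P.coeff e * φ e)) = 0 := by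
    apply MvPolynomial.funext
    intro y
    have := h (fun j => y (some j)) (y none)
    rw [map_zero, map_sum, ← this]
    refine Finset.sum_congr rfl fun e _ => ?_
    rw [MvPolynomial.eval_monomial, Finsupp.prod_fintype _ _ (by simp), Fintype.prod_option]
  have h2 := congrArg (MvPolynomial.coeff d) key
  rw [MvPolynomial.coeff_sum] at h2
  simp only [MvPolynomial.coeff_monomial, Finset.sum_ite_eq', hd, if_true,
    MvPolynomial.coeff_zero, mul_eq_zero] at h2
  exact h2.resolve_left (MvPolynomial.mem_support_iff.mp hd)

/-- The single scaling factor `2` suffices, because its powers separate the weights. -/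
theorem QuasiHomogeneous.weight_eq {m : ℕ} {p : Fin m → ℕ} {r : ℕ} {f : Fin m → SysPoly m}
    (h : QuasiHomogeneous p r f) (i : Fin m) {d : Option (Fin m) →₀ ℕ}
    (hd : d ∈ (f i).support) : monomialWeight p r d = p i + 1 := by
  have := (f i).eq_zero_of_sum_eq_zero
    (fun d => (2 : ℂ) ^ monomialWeight p r d - 2 ^ (p i + 1)) (fun x z => by
      have := h i 2 x z
      rw [SysPoly.at_smul_eq_sum, SysPoly.at_eq_sum, Finset.mul_sum, ← sub_eq_zero,
        ← Finset.sum_sub_distrib] at this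
      rw [← this]
      exact Finset.sum_congr rfl fun d _ => by ring) hd
  have h2 : ((2 ^ monomialWeight p r d : ℕ) : ℂ) = ((2 ^ (p i + 1) : ℕ) : ℂ) := by
    push_cast
    exact sub_eq_zero.mp this
  exact Nat.pow_right_injective le_rfl (Nat.cast_injective h2)

/-- A polynomial of degree at least `q` dominates `μ ^ q`, so it would be `o` of itself; but it has
positive degree and does not vanish far out. -/
theorem Polynomial.coeff_eq_zero_of_isLittleO_pow {P : ℂ[X]} {q k : ℕ} (hq : 0 < q)
    (h : P.eval =o[Bornology.cobounded ℂ] fun μ : ℂ => μ ^ q) (hk : q ≤ k) : P.coeff k = 0 := by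
  by_contra hc
  have hdeg : q ≤ P.natDegree := hk.trans (Polynomial.le_natDegree_of_ne_zero hc)
  have hP : P ≠ 0 := by rintro rfl; simp at hc
  have hX : (fun μ : ℂ => μ ^ q) =O[Bornology.cobounded ℂ] P.eval := by
    have := Polynomial.isBigO_cobounded_of_degree_le (P := (Polynomial.X ^ q : ℂ[X])) (Q := P)
      (by rw [Polynomial.degree_X_pow, Polynomial.degree_eq_natDegree hP]; exact_mod_cast hdeg)
    simpa using this
  have hpos : 0 < P.degree := Polynomial.natDegree_pos_iff_degree_pos.mp (hq.trans_le hdeg)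
  refine Asymptotics.isLittleO_irrefl (Filter.Eventually.frequently ?_) (h.trans_isBigO hX)
  have ht := P.tendsto_norm_atTop hpos (tendsto_norm_cobounded_atTop (E := ℂ))
  filter_upwards [ht.eventually_gt_atTop 0] with μ hμ
  exact norm_pos_iff.mp hμ

theorem SmallPerturbation.weight_lt {m : ℕ} {p : Fin m → ℕ} {r : ℕ} {g : Fin m → SysPoly m}
    (h : SmallPerturbation p r g) (i : Fin m) {d : Option (Fin m) →₀ ℕ}
    (hd : d ∈ (g i).support) : monomialWeight p r d < p i + 1 := by
  by_contra hlt
  have := (g i).eq_zero_of_sum_eq_zero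
    (fun e => if monomialWeight p r e = monomialWeight p r d then 1 else 0) (fun x z => by
      -- For a fixed point, the scaled value is a polynomial `Q` in `μ` whose coefficients collect
      -- the monomials of equal weight.
      set Q : ℂ[X] := ∑ e ∈ (g i).support, Polynomial.monomial (monomialWeight p r e)
        ((g i).coeff e * (z ^ e none * ∏ j, x j ^ e (some j))) with hQ
      have hQo : Q.eval =o[Bornology.cobounded ℂ] fun μ : ℂ => μ ^ (p i + 1) := by
        refine (h i x z).congr_left fun μ => ?_
        rw [SysPoly.at_smul_eq_sum, hQ, Polynomial.eval_finsetSum]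
        refine Finset.sum_congr rfl fun e _ => ?_
        rw [Polynomial.eval_monomial]
        ring
      have hc := Polynomial.coeff_eq_zero_of_isLittleO_pow (Nat.succ_pos _) hQo (not_lt.mp hlt)
      rw [hQ, Polynomial.finsetSum_coeff] at hc
      refine Eq.trans (Finset.sum_congr rfl fun e _ => ?_) hc
      rw [Polynomial.coeff_monomial]
      split_ifs <;> ring) hd
  simp at this

theorem Autonomous.degree_eq_zero {m : ℕ} {f : Fin m → SysPoly m}
    (h : Autonomous f) (i : Fin m) {d : Option (Fin m) →₀ ℕ}
    (hd : d ∈ (f i).support) : d none = 0 := by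
  have := (f i).eq_zero_of_sum_eq_zero
    (fun e => (2 : ℂ) ^ e none - 1) (fun x z => by
      have := h i x (2 * z) z
      rw [SysPoly.at_eq_sum, SysPoly.at_eq_sum, ← sub_eq_zero, ← Finset.sum_sub_distrib] at this
      rw [← this]
      refine Finset.sum_congr rfl fun d _ => ?_
      rw [mul_pow]
      ring) hd
  have h2 : ((2 ^ d none : ℕ) : ℂ) = ((2 ^ 0 : ℕ) : ℂ) := by
    push_cast
    simpa using sub_eq_zero.mp this
  exact Nat.pow_right_injective le_rfl (Nat.cast_injective h2)

theorem AdmissibleWeight.degree_eq_zero {m : ℕ} {p : Fin m → ℕ} {f : Fin m → SysPoly m}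
    (h : AdmissibleWeight p 0 f) (i : Fin m) {d : Option (Fin m) →₀ ℕ}
    (hd : d ∈ (f i).support) : d none = 0 :=
  Autonomous.degree_eq_zero (h.2.resolve_left (lt_irrefl 0)).2 i hd

/-! ### Leading terms of quasi-homogeneous polynomials -/

/-- An abstract leading term calculus: `H s x a` says that `x ∈ A` has order at least `s`, with
coefficient `a ∈ K` in order exactly `s`. -/
structure IsLeadingRelation {A K : Type*} [CommRing A] [CommRing K] (cA : ℂ →+* A) (cK : ℂ →+* K)
    (H : ℝ → A → K → Prop) : Prop where
  const : ∀ c : ℂ, H 0 (cA c) (cK c)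
  zero : ∀ s, H s 0 0
  add : ∀ {s x y a b}, H s x a → H s y b → H s (x + y) (a + b)
  mul : ∀ {s t x y a b}, H s x a → H t y b → H (s + t) (x * y) (a * b)
  lower : ∀ {s t x a}, s < t → H t x a → H s x 0

namespace IsLeadingRelation

variable {A K : Type*} [CommRing A] [CommRing K] {cA : ℂ →+* A} {cK : ℂ →+* K}
  {H : ℝ → A → K → Prop}

theorem one (h : IsLeadingRelation cA cK H) : H 0 1 1 := by
  simpa using h.const 1

theorem pow (h : IsLeadingRelation cA cK H) {s : ℝ} {x : A} {a : K} (hx : H s x a) (n : ℕ) :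
    H (n * s) (x ^ n) (a ^ n) := by
  induction n with
  | zero => simpa using h.one
  | succ n ih =>
    have := h.mul ih hx
    rw [pow_succ, pow_succ]
    convert this using 1
    push_cast
    ring

theorem sum (h : IsLeadingRelation cA cK H) {ι : Type*} (S : Finset ι) {s : ℝ} {x : ι → A}
    {a : ι → K} (hx : ∀ i ∈ S, H s (x i) (a i)) : H s (∑ i ∈ S, x i) (∑ i ∈ S, a i) := by
  classical
  induction S using Finset.induction_on with
  | empty => simpa using h.zero s
  | insert i S hi ih =>
    rw [Finset.sum_insert hi, Finset.sum_insert hi]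
    exact h.add (hx i (Finset.mem_insert_self i S))
      (ih fun j hj => hx j (Finset.mem_insert_of_mem hj))

theorem prod (h : IsLeadingRelation cA cK H) {ι : Type*} (S : Finset ι) {s : ι → ℝ} {x : ι → A}
    {a : ι → K} (hx : ∀ i ∈ S, H (s i) (x i) (a i)) :
    H (∑ i ∈ S, s i) (∏ i ∈ S, x i) (∏ i ∈ S, a i) := by
  classical
  induction S using Finset.induction_on with
  | empty => simpa using h.one
  | insert i S hi ih =>
    rw [Finset.sum_insert hi, Finset.prod_insert hi, Finset.prod_insert hi]
    exact h.mul (hx i (Finset.mem_insert_self i S))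
      (ih fun j hj => hx j (Finset.mem_insert_of_mem hj))

variable {m : ℕ} {p : Fin m → ℕ} {r : ℕ} {v : ℝ} {x : Fin m → A} {y : Fin m → K} {Z : A} {ζ : K}

theorem monomial (h : IsLeadingRelation cA cK H)
    (hx : ∀ j, H (-v * p j) (x j) (y j)) (hZ : H (-v * r) Z ζ) (c : ℂ)
    (d : Option (Fin m) →₀ ℕ) :
    H (-v * monomialWeight p r d) (cA c * ∏ o, (o.elim Z x) ^ d o)
      (cK c * ∏ o, (o.elim ζ y) ^ d o) := by
  simp only [Fintype.prod_option, Option.elim_none, Option.elim_some]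
  have := h.mul (h.const c) (h.mul (h.pow hZ (d none))
    (h.prod Finset.univ fun j _ => h.pow (hx j) (d (some j))))
  convert this using 1
  rw [monomialWeight]
  push_cast
  rw [mul_add, Finset.mul_sum, zero_add]
  congr 1
  · ring
  · exact Finset.sum_congr rfl fun j _ => by ring

theorem eval₂_of_weight_eq (h : IsLeadingRelation cA cK H)
    (hx : ∀ j, H (-v * p j) (x j) (y j)) (hZ : H (-v * r) Z ζ) {P : SysPoly m} {q : ℕ}
    (hP : ∀ d ∈ P.support, monomialWeight p r d = q) :
    H (-v * q) (MvPolynomial.eval₂ cA (fun o => o.elim Z x) P)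
      (MvPolynomial.eval₂ cK (fun o => o.elim ζ y) P) := by
  rw [MvPolynomial.eval₂_eq', MvPolynomial.eval₂_eq']
  refine h.sum _ fun d hd => ?_
  rw [← hP d hd]
  exact h.monomial hx hZ _ d

theorem eval₂_of_weight_lt (h : IsLeadingRelation cA cK H) (hv : 0 < v)
    (hx : ∀ j, H (-v * p j) (x j) (y j)) (hZ : H (-v * r) Z ζ) {P : SysPoly m} {q : ℕ}
    (hP : ∀ d ∈ P.support, monomialWeight p r d < q) :
    H (-v * q) (MvPolynomial.eval₂ cA (fun o => o.elim Z x) P) 0 := by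
  rw [MvPolynomial.eval₂_eq', ← Finset.sum_const_zero (s := P.support)]
  refine h.sum _ fun d hd => h.lower ?_ (h.monomial hx hZ _ d)
  have : (monomialWeight p r d : ℝ) < q := by exact_mod_cast hP d hd
  nlinarith

/-- The leading terms of the quasi-homogeneous part. -/
theorem quasiHomogeneous (h : IsLeadingRelation cA cK H) (hv : 0 < v) {f : Fin m → SysPoly m}
    (hw : AdmissibleWeight p r f) (hA1 : QuasiHomogeneous p r f)
    (hx : ∀ j, H (-v * p j) (x j) (y j)) (hZ : H 0 Z ζ) (i : Fin m) :
    H (-v * (p i + 1)) (MvPolynomial.eval₂ cA (fun o => o.elim Z x) (f i))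
      (MvPolynomial.eval₂ cK (fun o => o.elim 0 y) (f i)) := by
  -- For `r = 0` the variable `z` does not occur in `f`, so its value may be replaced by `0`. For `r
  -- > 0`, `Z` has order at least `0 > -v r`, so its coefficient in order `-v r` is `0`.
  rcases Nat.eq_zero_or_pos r with rfl | hr
  · have := h.eval₂_of_weight_eq hx (r := 0) (by simpa using hZ) fun d hd => hA1.weight_eq i hd
    push_cast at this
    convert this using 1
    rw [MvPolynomial.eval₂_eq', MvPolynomial.eval₂_eq']
    refine Finset.sum_congr rfl fun d hd => ?_
    rw [Fintype.prod_option, Fintype.prod_option, hw.degree_eq_zero i hd]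
    simp
  · have hr' : (0 : ℝ) < r := by exact_mod_cast hr
    have := h.eval₂_of_weight_eq hx (h.lower (by nlinarith) hZ) fun d hd => hA1.weight_eq i hd
    push_cast at this
    exact this

/-- The perturbation does not contribute to the leading terms. -/
theorem smallPerturbation (h : IsLeadingRelation cA cK H) (hv : 0 < v) {g : Fin m → SysPoly m}
    (hA2 : SmallPerturbation p r g)
    (hx : ∀ j, H (-v * p j) (x j) (y j)) (hZ : H 0 Z ζ) (i : Fin m) :
    H (-v * (p i + 1)) (MvPolynomial.eval₂ cA (fun o => o.elim Z x) (g i)) 0 := by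
  have key : ∃ ξ, H (-v * r) Z ξ := by
    rcases Nat.eq_zero_or_pos r with rfl | hr
    · exact ⟨ζ, by simpa using hZ⟩
    · have hr' : (0 : ℝ) < r := by exact_mod_cast hr
      exact ⟨0, h.lower (by nlinarith) hZ⟩
  obtain ⟨ξ, hξ⟩ := key
  have := h.eval₂_of_weight_lt hv hx hξ fun d hd => hA2.weight_lt i hd
  push_cast at this
  exact this

end IsLeadingRelation

/-! ### Growth of polynomial solutions in `log T` -/

/-- The leading relation of a polynomial function for `t → +∞`. -/
def Polynomial.LeadingAtTop (s : ℝ) (P : ℂ[X]) (a : ℂ) : Prop :=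
  Filter.Tendsto (fun t : ℝ => ((t ^ s : ℝ) : ℂ) * P.eval (t : ℂ)) Filter.atTop (nhds a)

/-- The sign is that of an order in `1/t`: growth like `t ^ n` is order `-n`. -/
theorem Polynomial.leadingAtTop_of_natDegree_le {P : ℂ[X]} {n : ℕ} (h : P.natDegree ≤ n) :
    P.LeadingAtTop (-n) (P.coeff n) := by
  have key : ∀ k ≤ n, Filter.Tendsto (fun t : ℝ => ((t ^ (-n : ℝ) : ℝ) : ℂ) * (t : ℂ) ^ k)
      Filter.atTop (nhds (if k = n then 1 else 0)) := by
    intro k hk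
    have h1 : Filter.Tendsto (fun t : ℝ => t ^ (-((n : ℝ) - k))) Filter.atTop
        (nhds (if k = n then 1 else 0)) := by
      split_ifs with hkn
      · subst hkn; simp
      · apply tendsto_rpow_neg_atTop
        have : (k : ℝ) < n := by exact_mod_cast lt_of_le_of_ne hk hkn
        linarith
    have h2 := (Complex.continuous_ofReal.tendsto _).comp h1
    have h3 : ((if k = n then (1 : ℝ) else 0 : ℝ) : ℂ) = if k = n then 1 else 0 := by
      split_ifs <;> simp
    rw [h3] at h2
    refine h2.congr' ?_
    filter_upwards [Filter.eventually_gt_atTop (0 : ℝ)] with t ht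
    rw [Function.comp_apply, ← Complex.ofReal_pow, ← Complex.ofReal_mul, ← Real.rpow_natCast,
      ← Real.rpow_add ht]
    congr 2
    ring
  have h4 := tendsto_finsetSum (Finset.range (n + 1)) fun k hk =>
    (key k (Nat.lt_succ_iff.mp (Finset.mem_range.mp hk))).const_mul (P.coeff k)
  rw [Polynomial.LeadingAtTop]
  convert h4 using 1
  · ext t
    rw [Polynomial.eval_eq_sum_range' (Nat.lt_succ_of_le h), Finset.mul_sum]
    exact Finset.sum_congr rfl fun k _ => by ring
  · simp

theorem Polynomial.isLeadingRelation_leadingAtTop :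
    IsLeadingRelation (Polynomial.C : ℂ →+* ℂ[X]) (RingHom.id ℂ) Polynomial.LeadingAtTop where
  const c := by simp [Polynomial.LeadingAtTop]
  zero s := by simp [Polynomial.LeadingAtTop]
  add {s x y a b} hx hy := by
    rw [Polynomial.LeadingAtTop] at *
    exact (hx.add hy).congr fun t => by rw [Polynomial.eval_add, mul_add]
  mul {s t x y a b} hx hy := by
    rw [Polynomial.LeadingAtTop] at *
    refine (hx.mul hy).congr' ?_
    filter_upwards [Filter.eventually_gt_atTop (0 : ℝ)] with u hu
    rw [Real.rpow_add hu, Polynomial.eval_mul]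
    push_cast
    ring
  lower {s t x a} hst hx := by
    rw [Polynomial.LeadingAtTop] at *
    have h1 := (Complex.continuous_ofReal.tendsto _).comp
      (tendsto_rpow_neg_atTop (sub_pos.mpr hst))
    have h2 := h1.mul hx
    rw [Complex.ofReal_zero, zero_mul] at h2
    refine h2.congr' ?_
    filter_upwards [Filter.eventually_gt_atTop (0 : ℝ)] with u hu
    rw [Function.comp_apply, ← mul_assoc, ← Complex.ofReal_mul, ← Real.rpow_add hu]
    congr 3
    ring

theorem Polynomial.LeadingAtTop.unique {s : ℝ} {P : ℂ[X]} {a b : ℂ} (ha : P.LeadingAtTop s a)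
    (hb : P.LeadingAtTop s b) : a = b :=
  tendsto_nhds_unique ha hb

theorem truncated_eq_eval₂ {m : ℕ} (f : Fin m → SysPoly m) (y : Fin m → ℂ) (i : Fin m) :
    truncated f y i = MvPolynomial.eval₂ (RingHom.id ℂ) (fun o => o.elim 0 y) (f i) := by
  rw [MvPolynomial.eval₂_id]
  rfl

/-- A polynomial solution of the autonomous system `y_i' = p_i y_i + f_i^A(y)` is constant. -/
theorem natDegree_eq_zero_of_autonomous_system {m : ℕ} {p : Fin m → ℕ} {r : ℕ}
    {f : Fin m → SysPoly m} (hw : AdmissibleWeight p r f) (hA1 : QuasiHomogeneous p r f)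
    (hS : OnlyTrivialFixedPoint f) {y : Fin m → ℂ[X]}
    (hy : ∀ i, Polynomial.derivative (y i) - Polynomial.C (p i : ℂ) * y i
      = MvPolynomial.eval₂ Polynomial.C (fun o => o.elim 0 y) (f i)) (i : Fin m) :
    (y i).natDegree = 0 := by
  by_contra hi
  have hp : ∀ j, (0 : ℝ) < p j := fun j => by exact_mod_cast hw.1 j
  have : Nonempty (Fin m) := ⟨i⟩
  -- `v` is the largest weighted growth rate: each `t ^ (-v p_j) y_j(t)` has a limit `a_j`, and
  -- `a_k` is the leading coefficient of `y_k`.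
  obtain ⟨k, hk⟩ := Finite.exists_max fun j => ((y j).natDegree : ℝ) / p j
  set v : ℝ := ((y k).natDegree : ℝ) / p k with hv
  have hv0 : 0 < v := lt_of_lt_of_le
    (div_pos (by exact_mod_cast Nat.pos_of_ne_zero hi) (hp i)) (hk i)
  have hL := Polynomial.isLeadingRelation_leadingAtTop
  have hex : ∀ j, ∃ a, (y j).LeadingAtTop (-v * p j) a := by
    intro j
    have h1 := Polynomial.leadingAtTop_of_natDegree_le (le_refl (y j).natDegree)
    have h2 : ((y j).natDegree : ℝ) ≤ v * p j := (div_le_iff₀ (hp j)).mp (hk j)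
    rcases h2.eq_or_lt with h3 | h3
    · exact ⟨_, by rw [neg_mul, ← h3]; exact h1⟩
    · exact ⟨0, hL.lower (by linarith) h1⟩
  choose a ha using hex
  have hak : a k = (y k).coeff (y k).natDegree := by
    refine (ha k).unique ?_
    have h1 := Polynomial.leadingAtTop_of_natDegree_le (le_refl (y k).natDegree)
    have h2 : v * p k = (y k).natDegree := div_mul_cancel₀ _ (hp k).ne'
    rwa [neg_mul, h2]
  have hyk : (y k).natDegree ≠ 0 := by
    intro h0
    rw [hv, h0] at hv0
    simp at hv0
  -- The linear side grows at most like `t ^ (v p_j)`, which is negligible against `t ^ (v (p_j +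
  -- 1))`. In the limit only `f^A(a) = 0` remains, and (S) applies.
  have ha0 : a = 0 := by
    refine hS a (funext fun j => ?_)
    rw [truncated_eq_eval₂]
    refine (hL.quasiHomogeneous hv0 hw hA1 ha (hL.zero 0) j).unique ?_
    rw [← hy j]
    have h1 : (y j).LeadingAtTop (-v * (p j + 1)) 0 := hL.lower (by linarith) (ha j)
    have h2 : (Polynomial.derivative (y j)).LeadingAtTop (-v * (p j + 1)) 0 := by
      have h3 := Polynomial.leadingAtTop_of_natDegree_le
        ((Polynomial.natDegree_derivative_le (y j)).trans (Nat.sub_le _ 1))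
      refine hL.lower ?_ h3
      have h2 : ((y j).natDegree : ℝ) ≤ v * p j := (div_le_iff₀ (hp j)).mp (hk j)
      linarith
    have h3 := hL.mul (hL.const (-(p j : ℂ))) h1
    rw [zero_add, mul_zero] at h3
    have h4 := hL.add h2 h3
    rw [add_zero] at h4
    rw [sub_eq_add_neg, ← neg_mul, ← Polynomial.C_neg]
    exact h4
  rw [ha0, Pi.zero_apply, eq_comm, Polynomial.coeff_natDegree,
    Polynomial.leadingCoeff_eq_zero] at hak
  rw [hak] at hyk
  simp at hyk

/-! ### Leading terms of formal series -/

/-- The inclusion of the formal series into those with real exponents. -/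
def LogLaurent.toReal : LogLaurent →+* HahnSeries ℝ ℂ[X] :=
  HahnSeries.embDomainRingHom (Int.castAddHom ℝ) Int.cast_injective fun _ _ => Int.cast_le

theorem LogLaurent.coeff_toReal (x : LogLaurent) (n : ℤ) :
    (LogLaurent.toReal x).coeff n = x.coeff n :=
  HahnSeries.embDomain_coeff (f := ⟨⟨Int.cast, Int.cast_injective⟩, Int.cast_le⟩) (a := n)

theorem LogLaurent.coeff_toReal_of_ne (x : LogLaurent) {s : ℝ} (hs : ∀ n : ℤ, (n : ℝ) ≠ s) :
    (LogLaurent.toReal x).coeff s = 0 :=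
  HahnSeries.embDomain_of_notMem_range (f := ⟨⟨Int.cast, Int.cast_injective⟩, Int.cast_le⟩)
    (by rintro ⟨n, hn⟩; exact hs n hn)

/-- `x` has order at least the real number `s`, and `a` is its coefficient in order `s`. -/
def LogLaurent.Leading (s : ℝ) (x : LogLaurent) (a : ℂ[X]) : Prop :=
  (∀ t < s, (LogLaurent.toReal x).coeff t = 0) ∧ (LogLaurent.toReal x).coeff s = a

theorem LogLaurent.Leading.unique {s : ℝ} {x : LogLaurent} {a b : ℂ[X]}
    (ha : x.Leading s a) (hb : x.Leading s b) : a = b :=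
  ha.2.symm.trans hb.2

/-- Real orders are allowed because the numbers `-v p_j` need not be integers; in a noninteger order
the coefficient is `0`. -/
theorem LogLaurent.exists_leading {s : ℝ} {x : LogLaurent}
    (h : ∀ n : ℤ, (n : ℝ) < s → x.coeff n = 0) : ∃ a, x.Leading s a := by
  refine ⟨_, fun t ht => ?_, rfl⟩
  by_cases hn : ∃ n : ℤ, (n : ℝ) = t
  · obtain ⟨n, rfl⟩ := hn
    rw [LogLaurent.coeff_toReal, h n ht]
  · push Not at hn
    exact x.coeff_toReal_of_ne hn

theorem LogLaurent.isLeadingRelation_leading :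
    IsLeadingRelation LogLaurent.const (Polynomial.C : ℂ →+* ℂ[X]) LogLaurent.Leading where
  const c := by
    have : LogLaurent.toReal (LogLaurent.const c) = HahnSeries.C (Polynomial.C c) :=
      HahnSeries.embDomainRingHom_C
    rw [LogLaurent.Leading, this]
    exact ⟨fun t ht => HahnSeries.coeff_single_of_ne ht.ne, HahnSeries.coeff_single_same _ _⟩
  zero s := by simp [LogLaurent.Leading]
  add {s x y a b} hx hy := by
    refine ⟨fun t ht => ?_, ?_⟩
    · rw [map_add, HahnSeries.coeff_add, hx.1 t ht, hy.1 t ht, add_zero]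
    · rw [map_add, HahnSeries.coeff_add, hx.2, hy.2]
  mul {s t x y a b} hx hy := by
    refine ⟨fun u hu => ?_, ?_⟩
    · rw [map_mul, HahnSeries.coeff_mul]
      refine Finset.sum_eq_zero fun ij hij => ?_
      rw [Finset.mem_antidiagonal] at hij
      rcases lt_or_ge ij.1 s with h | h
      · exact absurd (hx.1 _ h) hij.1
      · exact absurd (hy.1 _ (by linarith [hij.2.2])) hij.2.1
    · rw [map_mul, HahnSeries.coeff_mul, ← hx.2, ← hy.2]
      rw [Finset.sum_eq_single (s, t)]
      · intro ij hij hne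
        rw [Finset.mem_antidiagonal] at hij
        rcases lt_trichotomy ij.1 s with h | h | h
        · exact absurd (hx.1 _ h) hij.1
        · exact absurd (Prod.ext h (by linarith [hij.2.2])) hne
        · exact absurd (hy.1 _ (by linarith [hij.2.2])) hij.2.1
      · intro hn
        rw [Finset.mem_antidiagonal] at hn
        by_contra hc
        exact hn ⟨left_ne_zero_of_mul hc, right_ne_zero_of_mul hc, rfl⟩
  lower {s t x a} hst hx := ⟨fun u hu => hx.1 u (hu.trans hst), hx.1 s hst⟩

theorem LogLaurent.leading_indep (z₀ : ℂ) :
    (LogLaurent.indep z₀).Leading 0 (Polynomial.C z₀) := by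
  have hL := LogLaurent.isLeadingRelation_leading
  have h1 : LogLaurent.Leading 0 (HahnSeries.single (1 : ℤ) (1 : ℂ[X])) 0 := by
    obtain ⟨a, ha⟩ := LogLaurent.exists_leading (s := 1)
      (x := HahnSeries.single (1 : ℤ) (1 : ℂ[X])) fun n hn => by
        rw [HahnSeries.coeff_single_of_ne]
        rintro rfl
        simp at hn
    exact hL.lower one_pos ha
  have := hL.add (hL.const z₀) h1
  rwa [add_zero] at this

/-- Termwise, `T^s a(log T)` has derivative `T^{s-1} (s a + a')(log T)`; in noninteger orders both
sides vanish. -/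
theorem LogLaurent.Leading.deriv {s : ℝ} {x : LogLaurent} {a : ℂ[X]} (h : x.Leading s a) :
    x.deriv.Leading (s - 1) (Polynomial.C (s : ℂ) * a + Polynomial.derivative a) := by
  have key : ∀ t, (LogLaurent.toReal x.deriv).coeff (t - 1)
      = Polynomial.C (t : ℂ) * (LogLaurent.toReal x).coeff t
        + Polynomial.derivative ((LogLaurent.toReal x).coeff t) := by
    intro t
    by_cases hn : ∃ n : ℤ, (n : ℝ) = t
    · obtain ⟨n, rfl⟩ := hn
      have : (n : ℝ) - 1 = ((n - 1 : ℤ) : ℝ) := by push_cast; ring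
      rw [this, LogLaurent.coeff_toReal, LogLaurent.coeff_toReal, LogLaurent.coeff_deriv]
      simp
    · push Not at hn
      rw [x.coeff_toReal_of_ne hn, LogLaurent.coeff_toReal_of_ne]
      · simp
      · intro n hn'
        apply hn (n + 1)
        push_cast
        linarith
  refine ⟨fun t ht => ?_, ?_⟩
  · have := key (t + 1)
    rw [h.1 (t + 1) (by linarith), add_sub_cancel_right] at this
    simpa using this
  · rw [key s, h.2]

/-- Differentiation lowers the degree, so it cannot cancel the top coefficient of `c y`. -/
theorem Polynomial.eq_zero_of_derivative_eq_smul {y : ℂ[X]} {c : ℂ} (hc : c ≠ 0)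
    (h : Polynomial.C c * y + Polynomial.derivative y = 0) : y = 0 := by
  by_contra hy
  have h1 := congrArg (fun P => Polynomial.coeff P y.natDegree) h
  have h2 : (Polynomial.derivative y).coeff y.natDegree = 0 := by
    rw [Polynomial.coeff_derivative,
      Polynomial.coeff_eq_zero_of_natDegree_lt (Nat.lt_succ_self _), zero_mul]
  simp [h2, hc, hy] at h1

/-- The truncated system has no zeros in `ℂ[log T]` besides the origin. -/
theorem OnlyTrivialFixedPoint.eq_zero {m : ℕ} {f : Fin m → SysPoly m}
    (hS : OnlyTrivialFixedPoint f) {y : Fin m → ℂ[X]}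
    (hy : ∀ i, MvPolynomial.eval₂ Polynomial.C (fun o => o.elim 0 y) (f i) = 0) : y = 0 := by
  -- Giving `log T` any complex value `w` yields a zero of `f^A` in `ℂ^m`.
  have key : ∀ w, (fun i => (y i).eval w) = 0 := by
    intro w
    refine hS _ (funext fun i => ?_)
    have h := congrArg (Polynomial.evalRingHom w) (hy i)
    rw [MvPolynomial.hom_eval₂, map_zero] at h
    rw [truncated_eq_eval₂, Pi.zero_apply]
    refine Eq.trans ?_ h
    congr 1
    · ext c
      simp
    · ext o
      cases o <;> simp
  funext i
  refine Polynomial.funext fun w => ?_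
  simpa using congrFun (key w) i

/-- If some `x_i` has a pole, then the `x_i` start with `c_i T^{-p_i}`. -/
theorem exists_hasLeadingForm_of_order_neg {m : ℕ} {p : Fin m → ℕ} {r : ℕ}
    {f g : Fin m → SysPoly m} (hw : AdmissibleWeight p r f) (hA1 : QuasiHomogeneous p r f)
    (hA2 : SmallPerturbation p r g) (hS : OnlyTrivialFixedPoint f) {z₀ : ℂ}
    {x : Fin m → LogLaurent} (hsol : IsFormalSolution f g z₀ x) {i : Fin m}
    (hi : (x i).order < 0) : ∃ c : Fin m → ℂ, c ≠ 0 ∧ HasLeadingForm p c x := by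
  have hp : ∀ j, (0 : ℝ) < p j := fun j => by exact_mod_cast hw.1 j
  have : Nonempty (Fin m) := ⟨i⟩
  -- `v` is the largest weighted pole order; every `x_j` then has order at least `-v p_j`, with
  -- equality for `k`.
  obtain ⟨k, hk⟩ := Finite.exists_max fun j => -((x j).order : ℝ) / p j
  set v : ℝ := -((x k).order : ℝ) / p k with hv
  have hv0 : 0 < v := by
    refine lt_of_lt_of_le (div_pos ?_ (hp i)) (hk i)
    have : ((x i).order : ℝ) < 0 := by exact_mod_cast hi
    linarith
  have hL := LogLaurent.isLeadingRelation_leading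
  have hex : ∀ j, ∃ a, (x j).Leading (-v * p j) a := fun j => by
    refine LogLaurent.exists_leading fun n hn => HahnSeries.coeff_eq_zero_of_lt_order ?_
    have h1 := (div_le_iff₀ (hp j)).mp (hk j)
    have : (n : ℝ) < (x j).order := by linarith
    exact_mod_cast this
  choose y hy using hex
  have hvk : -v * p k = (x k).order := by
    rw [hv, neg_mul, div_mul_cancel₀ _ (hp k).ne', neg_neg]
  have hyk : y k ≠ 0 := by
    rw [← (hy k).2, hvk, LogLaurent.coeff_toReal]
    refine HahnSeries.coeff_order_eq_zero.not.mpr fun h0 => ?_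
    rw [hv, h0] at hv0
    simp at hv0
  have hrhs : ∀ j, (x j).deriv.Leading (-v * (p j + 1))
      (MvPolynomial.eval₂ Polynomial.C (fun o => o.elim 0 y) (f j)) := by
    intro j
    have h1 := hL.quasiHomogeneous hv0 hw hA1 hy (LogLaurent.leading_indep z₀) j
    have h2 := hL.smallPerturbation hv0 hA2 hy (LogLaurent.leading_indep z₀) j
    have h3 := hL.add h1 h2
    rw [add_zero] at h3
    rw [hsol j]
    exact h3
  -- The two sides start in orders `-v p_j - 1` and `-v (p_j + 1)`, which agree exactly for `v = 1`.
  -- Otherwise the side of lower order has vanishing coefficient there.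
  rcases lt_trichotomy v 1 with hv1 | hv1 | hv1
  · have h1 := hL.lower (by linarith : -v * p k - 1 < -v * (p k + 1)) (hrhs k)
    have h2 := h1.unique (hy k).deriv
    refine absurd (Polynomial.eq_zero_of_derivative_eq_smul ?_ h2.symm) hyk
    exact_mod_cast (by nlinarith [hp k] : -v * p k ≠ 0)
  · rw [hv1] at hy hrhs
    have h1 : ∀ j, Polynomial.derivative (y j) - Polynomial.C (p j : ℂ) * y j
        = MvPolynomial.eval₂ Polynomial.C (fun o => o.elim 0 y) (f j) := by
      intro j
      have h2 := hrhs j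
      rw [show (-1 : ℝ) * (p j + 1) = -1 * p j - 1 by ring] at h2
      rw [← (hy j).deriv.unique h2]
      push_cast
      rw [neg_one_mul, Polynomial.C_neg]
      ring
    have h2 := natDegree_eq_zero_of_autonomous_system hw hA1 hS h1
    refine ⟨fun j => (y j).coeff 0, fun h0 => hyk ?_, fun j => ⟨fun n hn => ?_, ?_⟩⟩
    · rw [Polynomial.eq_C_of_natDegree_eq_zero (h2 k)]
      simpa using congrFun h0 k
    · rw [← LogLaurent.coeff_toReal]
      refine (hy j).1 n ?_
      have : (n : ℝ) < ((-(p j : ℤ) : ℤ) : ℝ) := by exact_mod_cast hn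
      push_cast at this
      linarith
    · rw [← Polynomial.eq_C_of_natDegree_eq_zero (h2 j), ← (hy j).2, ← LogLaurent.coeff_toReal]
      congr 1
      push_cast
      ring
  · refine absurd (congrFun (hS.eq_zero fun j => ?_) k) hyk
    have h1 := hL.lower (by linarith : -v * (p j + 1) < -v * p j - 1) (hy j).deriv
    exact (hrhs j).unique h1

/-! ### Solutions without poles -/

theorem LogLaurent.ofPowerSeries_mk {x : LogLaurent} (h : ∀ n : ℤ, n < 0 → x.coeff n = 0) :
    HahnSeries.ofPowerSeries ℤ ℂ[X] (PowerSeries.mk fun n => x.coeff n) = x := by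
  ext n : 2
  rcases lt_or_ge n 0 with hn | hn
  · rw [h n hn, PowerSeries.coeff_coe, if_pos hn]
  · lift n to ℕ using hn
    rw [LaurentSeries.coeff_coe_powerSeries, PowerSeries.coeff_mk]

theorem LogLaurent.const_eq_ofPowerSeries (c : ℂ) :
    LogLaurent.const c
      = HahnSeries.ofPowerSeries ℤ ℂ[X] (PowerSeries.C (Polynomial.C c)) := by
  rw [HahnSeries.ofPowerSeries_C]
  rfl

theorem LogLaurent.indep_eq_ofPowerSeries (z₀ : ℂ) :
    LogLaurent.indep z₀ = HahnSeries.ofPowerSeries ℤ ℂ[X]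
      (PowerSeries.C (Polynomial.C z₀) + PowerSeries.X) := by
  rw [map_add, ← LogLaurent.const_eq_ofPowerSeries, HahnSeries.ofPowerSeries_X]
  rfl

theorem SysPoly.subst_ofPowerSeries {m : ℕ} (P : SysPoly m) (Y : Fin m → PowerSeries ℂ[X])
    (Z : PowerSeries ℂ[X]) :
    P.subst (fun j => HahnSeries.ofPowerSeries ℤ ℂ[X] (Y j)) (HahnSeries.ofPowerSeries ℤ ℂ[X] Z)
      = HahnSeries.ofPowerSeries ℤ ℂ[X]
        (MvPolynomial.eval₂ ((PowerSeries.C (R := ℂ[X])).comp Polynomial.C)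
          (fun o => o.elim Z Y) P) := by
  rw [MvPolynomial.hom_eval₂, SysPoly.subst]
  congr 1
  · ext1 c
    exact LogLaurent.const_eq_ofPowerSeries c
  · ext1 o
    cases o <;> rfl

/-- The power series whose first `n` coefficients are constants. -/
def constantCoeffBelow (n : ℕ) : Subring (PowerSeries ℂ[X]) where
  carrier := {x | ∀ k < n, PowerSeries.coeff k x ∈ (Polynomial.C : ℂ →+* ℂ[X]).range}
  mul_mem' {x y} hx hy k hk := by
    rw [PowerSeries.coeff_mul]
    refine Subring.sum_mem _ fun ij hij => ?_
    rw [Finset.HasAntidiagonal.mem_antidiagonal] at hij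
    exact Subring.mul_mem _ (hx _ (by omega)) (hy _ (by omega))
  one_mem' k _ := by
    rw [PowerSeries.coeff_one]
    split_ifs
    · exact Subring.one_mem _
    · exact Subring.zero_mem _
  add_mem' {x y} hx hy k hk := by
    rw [map_add]
    exact Subring.add_mem _ (hx k hk) (hy k hk)
  zero_mem' k _ := by
    rw [map_zero]
    exact Subring.zero_mem _
  neg_mem' {x} hx k hk := by
    rw [map_neg]
    exact Subring.neg_mem _ (hx k hk)

theorem constantCoeffBelow_C (n : ℕ) (c : ℂ) :
    PowerSeries.C (Polynomial.C c) ∈ constantCoeffBelow n := fun k _ => by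
  rw [PowerSeries.coeff_C]
  split_ifs
  · exact ⟨c, rfl⟩
  · exact Subring.zero_mem _

theorem constantCoeffBelow_X (n : ℕ) : PowerSeries.X ∈ constantCoeffBelow n := fun k _ => by
  rw [PowerSeries.coeff_X]
  split_ifs
  · exact Subring.one_mem _
  · exact Subring.zero_mem _

/-- The constant `b / (n + 1)` solves the same equation, and `n + 1` plus differentiation is
injective. -/
theorem Polynomial.mem_range_C_of_smul_add_derivative {a : ℂ[X]} {n : ℕ}
    (h : (n + 1 : ℤ) • a + Polynomial.derivative a ∈ (Polynomial.C : ℂ →+* ℂ[X]).range) :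
    a ∈ (Polynomial.C : ℂ →+* ℂ[X]).range := by
  obtain ⟨b, hb⟩ := h
  have hn : ((n + 1 : ℤ) : ℂ) ≠ 0 := by exact_mod_cast Nat.succ_ne_zero n
  refine ⟨b / ((n + 1 : ℤ) : ℂ), ?_⟩
  rw [eq_comm, ← sub_eq_zero]
  refine Polynomial.eq_zero_of_derivative_eq_smul hn ?_
  rw [Polynomial.derivative_sub, Polynomial.derivative_C, sub_zero, mul_sub, ← Polynomial.C_mul,
    mul_div_cancel₀ _ hn, hb, ← Polynomial.smul_eq_C_mul, Int.cast_smul_eq_zsmul]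
  abel

/-- A formal solution without poles is a tuple of formal power series. -/
theorem isRegular_of_order_nonneg {m : ℕ} {f g : Fin m → SysPoly m} {z₀ : ℂ}
    {x : Fin m → LogLaurent} (hsol : IsFormalSolution f g z₀ x) (hx : ∀ i, 0 ≤ (x i).order)
    (i : Fin m) : (x i).IsRegular := by
  have hneg : ∀ j (n : ℤ), n < 0 → (x j).coeff n = 0 := fun j n hn =>
    HahnSeries.coeff_eq_zero_of_lt_order (hn.trans_le (hx j))
  set Y : Fin m → PowerSeries ℂ[X] := fun j => PowerSeries.mk fun n => (x j).coeff n with hY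
  have hxY : x = fun j => HahnSeries.ofPowerSeries ℤ ℂ[X] (Y j) :=
    funext fun j => (LogLaurent.ofPowerSeries_mk (hneg j)).symm
  set Z : PowerSeries ℂ[X] := PowerSeries.C (Polynomial.C z₀) + PowerSeries.X with hZ
  set F : Fin m → PowerSeries ℂ[X] := fun j =>
    MvPolynomial.eval₂ ((PowerSeries.C (R := ℂ[X])).comp Polynomial.C)
      (fun o => o.elim Z Y) (f j + g j) with hF
  have hderiv : ∀ j, (x j).deriv = HahnSeries.ofPowerSeries ℤ ℂ[X] (F j) := by
    intro j
    rw [hsol j, hF, ← SysPoly.subst_ofPowerSeries, ← hxY, hZ, ← LogLaurent.indep_eq_ofPowerSeries]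
    exact (MvPolynomial.eval₂_add ..).symm
  -- The coefficient of `T ^ (k + 1)` is governed by the coefficient of `T ^ k` on the right, which
  -- involves only earlier coefficients.
  have key : ∀ n j, Y j ∈ constantCoeffBelow n := by
    intro n
    induction n with
    | zero => exact fun j k hk => absurd hk (Nat.not_lt_zero k)
    | succ n ih =>
      intro j k hk
      rcases Nat.lt_succ_iff_lt_or_eq.mp hk with hk | rfl
      · exact ih j k hk
      rw [hY, PowerSeries.coeff_mk]
      cases k with
      | zero =>
        -- A logarithm in the constant term would give the derivative a term in `T⁻¹`, which the
        -- right-hand side does not have.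
        have h1 := LogLaurent.coeff_deriv (x j) (-1)
        rw [hderiv j, PowerSeries.coeff_coe, if_pos (by norm_num), neg_add_cancel, zero_smul,
          zero_add] at h1
        exact ⟨_, (Polynomial.eq_C_of_derivative_eq_zero h1.symm).symm⟩
      | succ k =>
        have h1 := LogLaurent.coeff_deriv (x j) k
        rw [hderiv j, LaurentSeries.coeff_coe_powerSeries] at h1
        have h2 : F j ∈ constantCoeffBelow (k + 1) := by
          refine MvPolynomial.eval₂_mem (fun d _ => constantCoeffBelow_C _ _) fun o => ?_
          cases o with
          | none => exact Subring.add_mem _ (constantCoeffBelow_C _ _) (constantCoeffBelow_X _)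
          | some l => exact ih l
        have h3 := h2 k (Nat.lt_succ_self k)
        rw [h1] at h3
        have h4 := Polynomial.mem_range_C_of_smul_add_derivative h3
        exact_mod_cast h4
  refine ⟨hneg i, fun n => ?_⟩
  rcases lt_or_ge n 0 with hn | hn
  · exact ⟨0, by rw [hneg i n hn, map_zero]⟩
  · lift n to ℕ using hn
    obtain ⟨a, ha⟩ := key (n + 1) i n (Nat.lt_succ_self n)
    exact ⟨a, by rw [ha, hY, PowerSeries.coeff_mk]⟩

theorem exists_hasLeadingForm {m : ℕ} {p : Fin m → ℕ} {r : ℕ}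
    {f g : Fin m → SysPoly m} (hw : AdmissibleWeight p r f) (hA1 : QuasiHomogeneous p r f)
    (hA2 : SmallPerturbation p r g) (hS : OnlyTrivialFixedPoint f) {z₀ : ℂ}
    {x : Fin m → LogLaurent} (hsol : IsFormalSolution f g z₀ x) (hsing : IsSingular x) :
    ∃ c : Fin m → ℂ, c ≠ 0 ∧ HasLeadingForm p c x := by
  by_cases h : ∃ i, (x i).order < 0
  · obtain ⟨i, hi⟩ := h
    exact exists_hasLeadingForm_of_order_neg hw hA1 hA2 hS hsol hi
  · push Not at h
    obtain ⟨i, hi⟩ := hsing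
    exact absurd (isRegular_of_order_nonneg hsol h i) hi

/-! ### Submultiplicative norms on polynomials and power series -/

/-- A submultiplicative seminorm on a `ℂ`-algebra, with values at most `‖c‖` at the constants. -/
structure IsAlgSeminorm {A : Type*} [CommRing A] (ι : ℂ →+* A) (N : A → ℝ) : Prop where
  nonneg : ∀ a, 0 ≤ N a
  zero : N 0 = 0
  add_le : ∀ a b, N (a + b) ≤ N a + N b
  mul_le : ∀ a b, N (a * b) ≤ N a * N b
  const_le : ∀ c, N (ι c) ≤ ‖c‖

namespace IsAlgSeminorm

variable {A : Type*} [CommRing A] {ι : ℂ →+* A} {N : A → ℝ}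

theorem one_le (h : IsAlgSeminorm ι N) : N 1 ≤ 1 := by
  simpa using h.const_le 1

theorem sum_le (h : IsAlgSeminorm ι N) {κ : Type*} (s : Finset κ) (a : κ → A) :
    N (∑ k ∈ s, a k) ≤ ∑ k ∈ s, N (a k) := by
  classical
  induction s using Finset.induction_on with
  | empty => simp [h.zero]
  | insert k s hk ih =>
    rw [Finset.sum_insert hk, Finset.sum_insert hk]
    exact (h.add_le _ _).trans (by gcongr)

theorem pow_le (h : IsAlgSeminorm ι N) {a : A} {b : ℝ} (hab : N a ≤ b) (n : ℕ) :
    N (a ^ n) ≤ b ^ n := by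
  have hb := (h.nonneg a).trans hab
  induction n with
  | zero => simpa using h.one_le
  | succ n ih =>
    rw [pow_succ, pow_succ]
    exact (h.mul_le _ _).trans (mul_le_mul ih hab (h.nonneg _) (pow_nonneg hb n))

theorem prod_le (h : IsAlgSeminorm ι N) {κ : Type*} (s : Finset κ) {a : κ → A} {b : κ → ℝ}
    (hab : ∀ k, N (a k) ≤ b k) : N (∏ k ∈ s, a k) ≤ ∏ k ∈ s, b k := by
  classical
  induction s using Finset.induction_on with
  | empty => simpa using h.one_le
  | insert k s hk ih =>
    rw [Finset.prod_insert hk, Finset.prod_insert hk]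
    exact (h.mul_le _ _).trans
      (mul_le_mul (hab k) ih (h.nonneg _) ((h.nonneg _).trans (hab k)))

/-- A polynomial without constant term is small where the variables are small. -/
theorem eval₂_le (h : IsAlgSeminorm ι N) {σ : Type*} [Fintype σ] {P : MvPolynomial σ ℂ}
    (hP : P.coeff 0 = 0) {y : σ → A} {t : ℝ} (ht : t ≤ 1) (hy : ∀ o, N (y o) ≤ t) :
    N (MvPolynomial.eval₂ ι y P) ≤ (∑ d ∈ P.support, ‖P.coeff d‖) * t := by
  rw [MvPolynomial.eval₂_eq', Finset.sum_mul]
  refine (h.sum_le _ _).trans (Finset.sum_le_sum fun d hd => ?_)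
  have hd0 : ∃ o, d o ≠ 0 := by
    by_contra hd0
    push Not at hd0
    exact MvPolynomial.mem_support_iff.mp hd ((Finsupp.ext hd0 : d = 0) ▸ hP)
  obtain ⟨o, ho⟩ := hd0
  have ht0 : 0 ≤ t := (h.nonneg _).trans (hy o)
  have h1 : N (∏ k, y k ^ d k) ≤ ∏ k, t ^ d k := h.prod_le _ fun k => h.pow_le (hy k) _
  have h2 : ∏ k, t ^ d k ≤ t := by
    rw [Finset.prod_pow_eq_pow_sum]
    refine pow_le_of_le_one ht0 ht fun h0 => ho ?_
    exact Finset.sum_eq_zero_iff.mp h0 o (Finset.mem_univ o)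
  exact (h.mul_le _ _).trans
    (mul_le_mul (h.const_le _) (h1.trans h2) (h.nonneg _) (norm_nonneg _))

end IsAlgSeminorm

/-- The weighted `ℓ¹`-norm of the coefficients of index at most `n`. -/
def PowerSeries.truncNorm {A : Type*} [CommRing A] (N : A → ℝ) (S : ℝ) (n : ℕ)
    (x : PowerSeries A) : ℝ :=
  ∑ k ∈ Finset.range (n + 1), N (PowerSeries.coeff k x) * S ^ k

/-- Truncation keeps submultiplicativity because pairs of indices with sum at most `n` are among the
pairs with both indices at most `n`. -/
theorem IsAlgSeminorm.truncNorm {A : Type*} [CommRing A] {ι : ℂ →+* A} {N : A → ℝ}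
    (h : IsAlgSeminorm ι N) {S : ℝ} (hS : 0 ≤ S) (n : ℕ) :
    IsAlgSeminorm ((PowerSeries.C (R := A)).comp ι) (PowerSeries.truncNorm N S n) where
  nonneg x := Finset.sum_nonneg fun k _ => mul_nonneg (h.nonneg _) (pow_nonneg hS k)
  zero := by simp [PowerSeries.truncNorm, h.zero]
  add_le x y := by
    rw [PowerSeries.truncNorm, PowerSeries.truncNorm, PowerSeries.truncNorm,
      ← Finset.sum_add_distrib]
    refine Finset.sum_le_sum fun k _ => ?_
    rw [← add_mul, map_add]
    exact mul_le_mul_of_nonneg_right (h.add_le _ _) (pow_nonneg hS k)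
  mul_le x y := by
    have h1 : ∀ k, N (PowerSeries.coeff k (x * y)) * S ^ k ≤
        ∑ ij ∈ Finset.HasAntidiagonal.antidiagonal k, (N (PowerSeries.coeff ij.1 x) * S ^ ij.1) *
          (N (PowerSeries.coeff ij.2 y) * S ^ ij.2) := by
      intro k
      rw [PowerSeries.coeff_mul]
      refine (mul_le_mul_of_nonneg_right (h.sum_le _ _) (pow_nonneg hS k)).trans ?_
      rw [Finset.sum_mul]
      refine Finset.sum_le_sum fun ij hij => ?_
      rw [← Finset.HasAntidiagonal.mem_antidiagonal.mp hij, pow_add]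
      refine (mul_le_mul_of_nonneg_right (h.mul_le _ _) (by positivity)).trans (le_of_eq ?_)
      ring
    refine (Finset.sum_le_sum fun k _ => h1 k).trans ?_
    rw [PowerSeries.truncNorm, PowerSeries.truncNorm, Finset.sum_mul_sum, ← Finset.sum_product',
      Finset.sum_sigma']
    have hinj : Set.InjOn (fun s : (_ : ℕ) × (ℕ × ℕ) => s.2)
        ((Finset.range (n + 1)).sigma fun k => Finset.HasAntidiagonal.antidiagonal k) := by
      rintro ⟨k, ij⟩ hk ⟨l, ij'⟩ hl rfl
      simp only [Finset.coe_sigma, Set.mem_sigma_iff, Finset.mem_coe,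
        Finset.HasAntidiagonal.mem_antidiagonal] at hk hl
      rw [← hk.2, ← hl.2]
    rw [← Finset.sum_image (f := fun ij : ℕ × ℕ => (N (PowerSeries.coeff ij.1 x) * S ^ ij.1) *
          (N (PowerSeries.coeff ij.2 y) * S ^ ij.2)) hinj]
    refine Finset.sum_le_sum_of_subset_of_nonneg ?_ fun ij _ _ =>
      mul_nonneg (mul_nonneg (h.nonneg _) (pow_nonneg hS _))
        (mul_nonneg (h.nonneg _) (pow_nonneg hS _))
    intro ij hij
    obtain ⟨s, hs, rfl⟩ := Finset.mem_image.mp hij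
    rw [Finset.mem_sigma, Finset.HasAntidiagonal.mem_antidiagonal, Finset.mem_range] at hs
    rw [Finset.mem_product, Finset.mem_range, Finset.mem_range]
    omega
  const_le c := by
    rw [PowerSeries.truncNorm, Finset.sum_eq_single 0]
    · simpa using h.const_le c
    · intro k _ hk
      simp [PowerSeries.coeff_C, hk, h.zero]
    · simp

theorem PowerSeries.truncNorm_X_le {A : Type*} [CommRing A] {ι : ℂ →+* A} {N : A → ℝ}
    (h : IsAlgSeminorm ι N) {S : ℝ} (hS : 0 ≤ S) (n : ℕ) :
    PowerSeries.truncNorm N S n PowerSeries.X ≤ S := by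
  have h1 : ∀ k, N (PowerSeries.coeff k PowerSeries.X) * S ^ k ≤ if k = 1 then S else 0 := by
    intro k
    rw [PowerSeries.coeff_X]
    split_ifs with hk
    · subst hk
      simpa using mul_le_mul_of_nonneg_right h.one_le hS
    · simp [h.zero]
  refine (Finset.sum_le_sum fun k _ => h1 k).trans ?_
  rw [Finset.sum_ite_eq']
  split_ifs
  · exact le_rfl
  · exact hS

/-- The weighted `ℓ¹`-norm of the coefficients of a polynomial. -/
def Polynomial.l1Norm (R : ℝ) (a : ℂ[X]) : ℝ :=
  a.sum fun k c => ‖c‖ * R ^ k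

/-- Transfers the seminorm properties from power series; `n` may be any degree bound, so polynomials
of different degrees can share a truncation. -/
theorem Polynomial.l1Norm_eq_truncNorm (R : ℝ) {a : ℂ[X]} {n : ℕ} (h : a.natDegree ≤ n) :
    a.l1Norm R = PowerSeries.truncNorm (fun c : ℂ => ‖c‖) R n (a : PowerSeries ℂ) := by
  rw [Polynomial.l1Norm, Polynomial.sum_over_range' a (by simp) (n + 1) (Nat.lt_succ_of_le h),
    PowerSeries.truncNorm]
  simp

theorem isAlgSeminorm_norm : IsAlgSeminorm (RingHom.id ℂ) (fun c : ℂ => ‖c‖) where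
  nonneg := norm_nonneg
  zero := norm_zero
  add_le := norm_add_le
  mul_le := norm_mul_le
  const_le _ := le_rfl

theorem Polynomial.isAlgSeminorm_l1Norm {R : ℝ} (hR : 0 ≤ R) :
    IsAlgSeminorm (Polynomial.C : ℂ →+* ℂ[X]) (Polynomial.l1Norm R) where
  nonneg a := by
    rw [Polynomial.l1Norm_eq_truncNorm R le_rfl]
    exact (isAlgSeminorm_norm.truncNorm hR _).nonneg _
  zero := by simp [Polynomial.l1Norm]
  add_le a b := by
    have h1 := Polynomial.natDegree_add_le a b
    rw [Polynomial.l1Norm_eq_truncNorm R h1,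
      Polynomial.l1Norm_eq_truncNorm R (le_max_left a.natDegree b.natDegree),
      Polynomial.l1Norm_eq_truncNorm R (le_max_right a.natDegree b.natDegree),
      Polynomial.coe_add]
    exact (isAlgSeminorm_norm.truncNorm hR _).add_le _ _
  mul_le a b := by
    rw [Polynomial.l1Norm_eq_truncNorm R (Polynomial.natDegree_mul_le (p := a) (q := b)),
      Polynomial.l1Norm_eq_truncNorm R (Nat.le_add_right a.natDegree b.natDegree),
      Polynomial.l1Norm_eq_truncNorm R (Nat.le_add_left b.natDegree a.natDegree),
      Polynomial.coe_mul]
    exact (isAlgSeminorm_norm.truncNorm hR _).mul_le _ _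
  const_le c := by simp [Polynomial.l1Norm]

theorem Polynomial.l1Norm_natCast_mul (R : ℝ) (n : ℕ) (a : ℂ[X]) :
    ((n : ℂ[X]) * a).l1Norm R = n * a.l1Norm R := by
  have h : ((n : ℂ[X]) * a).natDegree ≤ a.natDegree := by
    refine Polynomial.natDegree_mul_le.trans ?_
    simp
  rw [Polynomial.l1Norm, Polynomial.l1Norm,
    Polynomial.sum_over_range' _ (by simp) (a.natDegree + 1) (Nat.lt_succ_of_le h),
    Polynomial.sum_over_range _ (by simp), Finset.mul_sum]
  refine Finset.sum_congr rfl fun k _ => ?_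
  rw [Polynomial.coeff_natCast_mul, norm_mul, Complex.norm_natCast, mul_assoc]

/-- Passing from `X ^ k` to `k X ^ (k - 1)` multiplies the norm by `k / R`. For large `R`
differentiation is thus a small perturbation. -/
theorem Polynomial.l1Norm_derivative_mul_le {R : ℝ} (hR : 0 ≤ R) (a : ℂ[X]) :
    (Polynomial.derivative a).l1Norm R * R ≤ a.natDegree * a.l1Norm R := by
  rw [Polynomial.l1Norm, Polynomial.l1Norm,
    Polynomial.sum_over_range' _ (by simp) (a.natDegree + 1)
      (Nat.lt_succ_of_le ((Polynomial.natDegree_derivative_le a).trans (Nat.sub_le _ 1))),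
    Polynomial.sum_over_range' a (by simp) (a.natDegree + 1 + 1) (by omega), Finset.sum_mul,
    Finset.mul_sum, Finset.sum_range_succ' _ (a.natDegree + 1)]
  refine le_add_of_le_of_nonneg (Finset.sum_le_sum fun k hk => ?_) (by positivity)
  rw [Polynomial.coeff_derivative, norm_mul]
  have h1 : ‖a.coeff (k + 1)‖ * ‖(k : ℂ) + 1‖ ≤ a.natDegree * ‖a.coeff (k + 1)‖ := by
    rcases Nat.lt_or_ge a.natDegree (k + 1) with h | h
    · rw [Polynomial.coeff_eq_zero_of_natDegree_lt h]
      simp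
    · rw [mul_comm]
      refine mul_le_mul_of_nonneg_right ?_ (norm_nonneg _)
      have : ((k : ℂ) + 1) = ((k + 1 : ℕ) : ℂ) := by push_cast; rfl
      rw [this, Complex.norm_natCast]
      exact_mod_cast h
  calc ‖a.coeff (k + 1)‖ * ‖(k : ℂ) + 1‖ * R ^ k * R
      = ‖a.coeff (k + 1)‖ * ‖(k : ℂ) + 1‖ * R ^ (k + 1) := by ring
    _ ≤ a.natDegree * ‖a.coeff (k + 1)‖ * R ^ (k + 1) := by gcongr
    _ = _ := by ring

theorem Polynomial.norm_eval_le_l1Norm {R : ℝ} {w : ℂ} (hw : ‖w‖ ≤ R) (a : ℂ[X]) :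
    ‖a.eval w‖ ≤ a.l1Norm R := by
  rw [Polynomial.eval_eq_sum, Polynomial.l1Norm, Polynomial.sum, Polynomial.sum]
  refine (norm_sum_le _ _).trans (Finset.sum_le_sum fun k _ => ?_)
  rw [norm_mul, norm_pow]
  gcongr

theorem Polynomial.norm_coeff_mul_le_l1Norm {R : ℝ} (hR : 0 ≤ R) (a : ℂ[X]) (k : ℕ) :
    ‖a.coeff k‖ * R ^ k ≤ a.l1Norm R := by
  rw [Polynomial.l1Norm, Polynomial.sum]
  by_cases hk : k ∈ a.support
  · exact Finset.single_le_sum (f := fun k => ‖a.coeff k‖ * R ^ k)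
      (fun j _ => by positivity) hk
  · rw [Polynomial.notMem_support_iff.mp hk, norm_zero, zero_mul]
    exact Finset.sum_nonneg fun j _ => by positivity

theorem Polynomial.l1Norm_le_mul_pow {R : ℝ} (hR : 1 ≤ R) {a : ℂ[X]} {K : ℕ}
    (hK : a.natDegree ≤ K) : a.l1Norm R ≤ a.l1Norm 1 * R ^ K := by
  rw [Polynomial.l1Norm, Polynomial.l1Norm, Polynomial.sum, Polynomial.sum, Finset.sum_mul]
  refine Finset.sum_le_sum fun k hk => ?_
  rw [one_pow, mul_one]
  gcongr
  exact (Polynomial.le_natDegree_of_mem_supp k hk).trans hK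

/-- The degree of a polynomial is bounded by the growth of its norms. -/
theorem Polynomial.natDegree_le_of_l1Norm_le {a : ℂ[X]} {D : ℕ} {B R₀ : ℝ}
    (h : ∀ R, R₀ ≤ R → a.l1Norm R ≤ B * R ^ D) : a.natDegree ≤ D := by
  by_contra hD
  push Not at hD
  have ha : a ≠ 0 := by rintro rfl; simp at hD
  have hl : 0 < ‖a.leadingCoeff‖ := norm_pos_iff.mpr (Polynomial.leadingCoeff_ne_zero.mpr ha)
  set R := max (max R₀ 1) ((B + 1) / ‖a.leadingCoeff‖) with hRdef
  have hR1 : 1 ≤ R := (le_max_right R₀ 1).trans (le_max_left _ _)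
  have hR0 : R₀ ≤ R := (le_max_left R₀ 1).trans (le_max_left _ _)
  have hRB : B + 1 ≤ ‖a.leadingCoeff‖ * R := by
    rw [mul_comm]
    exact (div_le_iff₀ hl).mp (le_max_right _ _)
  have h1 := (Polynomial.norm_coeff_mul_le_l1Norm (zero_le_one.trans hR1) a a.natDegree).trans
    (h R hR0)
  have h2 : R ^ (D + 1) ≤ R ^ a.natDegree := pow_le_pow_right₀ hR1 hD
  have h3 : 0 < R ^ D := by positivity
  have h4 : ‖a.leadingCoeff‖ * R ^ (D + 1) ≤ B * R ^ D :=
    (mul_le_mul_of_nonneg_left h2 hl.le).trans h1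
  rw [pow_succ] at h4
  nlinarith

/-! ### Coefficient bounds for Briot-Bouquet systems -/

/-- The right-hand side `Φ(u(T), T)` of a system `T u' = Φ(u, T)` for power series `u`. -/
def SysPoly.substPowerSeries {m : ℕ} (P : SysPoly m) (u : Fin m → PowerSeries ℂ[X]) :
    PowerSeries ℂ[X] :=
  MvPolynomial.eval₂ ((PowerSeries.C (R := ℂ[X])).comp Polynomial.C)
    (fun o => o.elim PowerSeries.X u) P

/-- `u` has no constant term and solves `T u_i' = Φ_i(u, T)`, where `T` is the power series
variable and the polynomial variable of the coefficients is `log T`. -/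
structure IsBriotBouquetSolution {m : ℕ} (Φ : Fin m → SysPoly m)
    (u : Fin m → PowerSeries ℂ[X]) : Prop where
  coeff_zero : ∀ i, PowerSeries.coeff 0 (u i) = 0
  coeff_eq : ∀ (i : Fin m) (n : ℕ), (n : ℂ[X]) * PowerSeries.coeff n (u i)
    + Polynomial.derivative (PowerSeries.coeff n (u i))
      = PowerSeries.coeff n ((Φ i).substPowerSeries u)

namespace IsBriotBouquetSolution

variable {m : ℕ} {Φ : Fin m → SysPoly m} {u : Fin m → PowerSeries ℂ[X]}

theorem constantCoeff_eq_zero (h : IsBriotBouquetSolution Φ u) (i : Fin m) :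
    (Φ i).coeff 0 = 0 := by
  have h1 := h.coeff_eq i 0
  rw [h.coeff_zero i, PowerSeries.coeff_zero_eq_constantCoeff_apply, SysPoly.substPowerSeries,
    MvPolynomial.hom_eval₂] at h1
  have h2 : (fun o : Option (Fin m) => (PowerSeries.constantCoeff (R := ℂ[X]))
      (o.elim PowerSeries.X u)) = fun o => (0 : ℂ[X]) := by
    ext1 o
    cases o with
    | none => simp
    | some j =>
      have := h.coeff_zero j
      rwa [PowerSeries.coeff_zero_eq_constantCoeff_apply] at this
  rw [h2, MvPolynomial.eval₂_zero'_apply] at h1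
  simpa [MvPolynomial.constantCoeff_eq] using h1.symm

/-- The degree hypothesis makes the norm of the derivative at most half of `n` times the norm of the
coefficient, so it can be absorbed. -/
theorem norm_coeff_le (h : IsBriotBouquetSolution Φ u) {R : ℝ} (hR : 1 ≤ R) {i : Fin m} {n : ℕ}
    (hn : 2 * ((PowerSeries.coeff n (u i)).natDegree : ℝ) ≤ n * R) :
    n * (PowerSeries.coeff n (u i)).l1Norm R
      ≤ 2 * (PowerSeries.coeff n ((Φ i).substPowerSeries u)).l1Norm R := by
  have hR0 : 0 < R := zero_lt_one.trans_le hR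
  have hN := Polynomial.isAlgSeminorm_l1Norm hR0.le
  set a := PowerSeries.coeff n (u i)
  have h1 : 2 * (Polynomial.derivative a).l1Norm R ≤ n * a.l1Norm R := by
    refine le_of_mul_le_mul_right ?_ hR0
    have h2 := Polynomial.l1Norm_derivative_mul_le hR0.le a
    have h3 := mul_le_mul_of_nonneg_right hn (hN.nonneg a)
    nlinarith
  have h2 : (n : ℂ[X]) * a = PowerSeries.coeff n ((Φ i).substPowerSeries u)
      + Polynomial.C (-1) * Polynomial.derivative a := by
    rw [← h.coeff_eq i n]
    simp only [map_neg, map_one]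
    ring
  have h3 : (Polynomial.C (-1 : ℂ) * Polynomial.derivative a).l1Norm R
      ≤ (Polynomial.derivative a).l1Norm R := by
    refine (hN.mul_le _ _).trans ?_
    refine (mul_le_mul_of_nonneg_right (hN.const_le _) (hN.nonneg _)).trans ?_
    simp
  have h4 := hN.add_le (PowerSeries.coeff n ((Φ i).substPowerSeries u))
    (Polynomial.C (-1) * Polynomial.derivative a)
  rw [← h2, Polynomial.l1Norm_natCast_mul] at h4
  linarith

/-- An a priori estimate: if the sum `U` of the norms is at most `1/2`, it is in fact `O(S)`. Since
`Φ` has no constant term, its norm is at most a multiple of `U + S`. For large `n` the factor `n`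
beats this multiple; the finitely many other coefficients are fixed data, so resonances do no harm.
-/
theorem sum_truncNorm_le (h : IsBriotBouquetSolution Φ u) :
    ∃ (K : ℕ) (B : ℝ), 1 ≤ B ∧ ∀ R, 1 ≤ R → ∀ N : ℕ,
      (∀ i, ∀ n ≤ N, 2 * ((PowerSeries.coeff n (u i)).natDegree : ℝ) ≤ n * R) →
      ∀ S, 0 ≤ S → S ≤ 1 / 2 →
        ∑ i, PowerSeries.truncNorm (Polynomial.l1Norm R) S N (u i) ≤ 1 / 2 →
        ∑ i, PowerSeries.truncNorm (Polynomial.l1Norm R) S N (u i) ≤ B * R ^ K * S := by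
  set C : ℝ := 1 + ∑ i, ∑ d ∈ (Φ i).support, ‖(Φ i).coeff d‖ with hC
  have hC1 : 1 ≤ C := le_add_of_nonneg_right (by positivity)
  -- Beyond `M`, the bound `n ‖a_n‖ ≤ 2 ‖Φ_n‖` contributes at most `U / 2` plus a multiple of `S`.
  -- `K` and `B` measure the coefficients up to `M` and do not depend on `R`, `S` or `N`.
  obtain ⟨M, hM⟩ := exists_nat_ge (4 * C)
  set K : ℕ := ∑ i, ∑ n ∈ Finset.range (M + 1), (PowerSeries.coeff n (u i)).natDegree with hK
  have hN1 := Polynomial.isAlgSeminorm_l1Norm zero_le_one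
  set B : ℝ := ∑ i, ∑ n ∈ Finset.range (M + 1), (PowerSeries.coeff n (u i)).l1Norm 1 with hB
  have hB0 : 0 ≤ B := Finset.sum_nonneg fun i _ => Finset.sum_nonneg fun n _ => hN1.nonneg _
  refine ⟨K, 1 + 2 * B, by linarith, fun R hR N hdeg S hS0 hS1 hU => ?_⟩
  have hR0 : 0 ≤ R := zero_le_one.trans hR
  have hN := Polynomial.isAlgSeminorm_l1Norm hR0
  have hT := hN.truncNorm hS0 N
  set U := ∑ i, PowerSeries.truncNorm (Polynomial.l1Norm R) S N (u i) with hUdef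
  have hU0 : 0 ≤ U := Finset.sum_nonneg fun i _ => hT.nonneg _
  have hΦ : ∀ i, PowerSeries.truncNorm (Polynomial.l1Norm R) S N ((Φ i).substPowerSeries u)
      ≤ (∑ d ∈ (Φ i).support, ‖(Φ i).coeff d‖) * (U + S) := by
    intro i
    refine hT.eval₂_le (h.constantCoeff_eq_zero i) (by linarith) fun o => ?_
    cases o with
    | none => exact (PowerSeries.truncNorm_X_le hN hS0 N).trans (by linarith)
    | some j =>
      have := Finset.single_le_sum (f := fun j =>
        PowerSeries.truncNorm (Polynomial.l1Norm R) S N (u j)) (fun i _ => hT.nonneg (u i))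
        (Finset.mem_univ j)
      exact this.trans (by linarith)
  have hlow : ∀ i, ∀ n ∈ Finset.range (N + 1),
      4 * C * ((PowerSeries.coeff n (u i)).l1Norm R * S ^ n) ≤
        2 * ((PowerSeries.coeff n ((Φ i).substPowerSeries u)).l1Norm R * S ^ n) +
        4 * C * (if n ∈ Finset.range (M + 1) then
          (PowerSeries.coeff n (u i)).l1Norm 1 * (R ^ K * S) else 0) := by
    intro i n hn
    have hSn : 0 ≤ S ^ n := pow_nonneg hS0 n
    split_ifs with hnM
    · refine le_add_of_nonneg_of_le (mul_nonneg zero_le_two (mul_nonneg (hN.nonneg _) hSn)) ?_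
      refine mul_le_mul_of_nonneg_left ?_ (by linarith)
      rcases Nat.eq_zero_or_pos n with rfl | hn0
      · rw [h.coeff_zero i, hN.zero, hN1.zero, zero_mul, zero_mul]
      · have h1 : (PowerSeries.coeff n (u i)).natDegree ≤ K := by
          refine le_trans ?_ (Finset.single_le_sum (fun j _ => Nat.zero_le _) (Finset.mem_univ i))
          exact Finset.single_le_sum
            (f := fun n => (PowerSeries.coeff n (u i)).natDegree) (fun j _ => Nat.zero_le _) hnM
        have h2 := Polynomial.l1Norm_le_mul_pow hR h1
        have h3 : S ^ n ≤ S := pow_le_of_le_one hS0 (by linarith) hn0.ne'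
        rw [← mul_assoc]
        exact mul_le_mul h2 h3 hSn (mul_nonneg (hN1.nonneg _) (pow_nonneg hR0 K))
    · rw [mul_zero, add_zero, ← mul_assoc, ← mul_assoc]
      refine mul_le_mul_of_nonneg_right ?_ hSn
      refine le_trans (mul_le_mul_of_nonneg_right ?_ (hN.nonneg _))
        (h.norm_coeff_le hR (hdeg i n (Nat.lt_succ_iff.mp (Finset.mem_range.mp hn))))
      rw [Finset.mem_range, not_lt] at hnM
      have : (M : ℝ) ≤ n := by exact_mod_cast (Nat.le_succ M).trans hnM
      linarith
  have hsum : ∀ i, 4 * C * PowerSeries.truncNorm (Polynomial.l1Norm R) S N (u i) ≤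
      2 * PowerSeries.truncNorm (Polynomial.l1Norm R) S N ((Φ i).substPowerSeries u) +
      4 * C * ((∑ n ∈ Finset.range (M + 1), (PowerSeries.coeff n (u i)).l1Norm 1)
        * (R ^ K * S)) := by
    intro i
    have h1 := Finset.sum_le_sum (hlow i)
    rw [← Finset.mul_sum, Finset.sum_add_distrib, ← Finset.mul_sum, ← Finset.mul_sum] at h1
    refine h1.trans ?_
    gcongr
    · exact le_rfl
    rw [Finset.sum_mul, ← Finset.sum_filter]
    exact Finset.sum_le_sum_of_subset_of_nonneg
      (fun n hn => (Finset.mem_filter.mp hn).2) fun n _ _ =>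
        mul_nonneg (hN1.nonneg _) (by positivity)
  have htot := Finset.sum_le_sum fun i (_ : i ∈ Finset.univ) => hsum i
  rw [← Finset.mul_sum, Finset.sum_add_distrib, ← Finset.mul_sum, ← Finset.mul_sum,
    ← Finset.sum_mul, ← hUdef, ← hB] at htot
  have hΦtot := Finset.sum_le_sum fun i (_ : i ∈ Finset.univ) => hΦ i
  rw [← Finset.sum_mul] at hΦtot
  have h1 : (∑ i, ∑ d ∈ (Φ i).support, ‖(Φ i).coeff d‖) * (U + S) ≤ C * (U + S) :=
    mul_le_mul_of_nonneg_right (by rw [hC]; linarith) (by linarith)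
  have h2 : 4 * C * U ≤ 2 * (C * (U + S)) + 4 * C * (B * (R ^ K * S)) := by linarith
  have h3 : C * U ≤ C * (S + 2 * (B * (R ^ K * S))) := by linarith
  have h4 := le_of_mul_le_mul_left h3 (by linarith)
  have h5 : S ≤ R ^ K * S := le_mul_of_one_le_left hS0 (one_le_pow₀ hR)
  linarith

/-- Continuity method in `S`: the sum of the norms vanishes at `S = 0`, and up to `S₀` the a priori
estimate improves `1/2` to `1/4`. By the intermediate value theorem `1/2` is never exceeded, and the
`N`-th term at `S₀` gives the bound. -/
theorem l1Norm_coeff_le_of_natDegree_le (h : IsBriotBouquetSolution Φ u) :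
    ∃ (K : ℕ) (B : ℝ), 1 ≤ B ∧ ∀ R, 1 ≤ R → ∀ N : ℕ,
      (∀ i, ∀ n ≤ N, 2 * ((PowerSeries.coeff n (u i)).natDegree : ℝ) ≤ n * R) →
      ∀ i, (PowerSeries.coeff N (u i)).l1Norm R ≤ (B * R ^ K) ^ N := by
  obtain ⟨K, B, hB, hbound⟩ := h.sum_truncNorm_le
  refine ⟨K, 4 * B, by linarith, fun R hR N hdeg i => ?_⟩
  have hR0 : 0 ≤ R := zero_le_one.trans hR
  have hN := Polynomial.isAlgSeminorm_l1Norm hR0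
  have hRK : 1 ≤ R ^ K := one_le_pow₀ hR
  have hBR : 1 ≤ B * R ^ K := one_le_mul_of_one_le_of_one_le hB hRK
  have hD : 0 < 4 * B * R ^ K := by linarith
  set S₀ : ℝ := (4 * B * R ^ K)⁻¹ with hS₀
  have hS₀0 : 0 < S₀ := inv_pos.mpr hD
  have hDS : 4 * B * R ^ K * S₀ = 1 := mul_inv_cancel₀ hD.ne'
  have hS₀1 : S₀ ≤ 1 / 2 := by nlinarith
  set U : ℝ → ℝ := fun S => ∑ i, PowerSeries.truncNorm (Polynomial.l1Norm R) S N (u i) with hU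
  have hUcont : Continuous U := by
    simp only [hU, PowerSeries.truncNorm]
    fun_prop
  have hUzero : U 0 = 0 := by
    refine Finset.sum_eq_zero fun j _ => Finset.sum_eq_zero fun n _ => ?_
    rcases Nat.eq_zero_or_pos n with rfl | hn
    · rw [h.coeff_zero j, hN.zero, zero_mul]
    · rw [zero_pow hn.ne', mul_zero]
  have hUS : U S₀ ≤ 1 / 2 := by
    by_contra hlt
    push Not at hlt
    obtain ⟨S, hS, hSU⟩ := intermediate_value_Icc hS₀0.le hUcont.continuousOn
      (show (1 / 2 : ℝ) ∈ Set.Icc (U 0) (U S₀) from ⟨by rw [hUzero]; norm_num, hlt.le⟩)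
    have h1 : U S ≤ B * R ^ K * S := hbound R hR N hdeg S hS.1 (hS.2.trans hS₀1) hSU.le
    have h2 : B * R ^ K * S ≤ B * R ^ K * S₀ := mul_le_mul_of_nonneg_left hS.2 (by linarith)
    linarith
  have h1 : (PowerSeries.coeff N (u i)).l1Norm R * S₀ ^ N ≤ U S₀ := by
    refine le_trans ?_ (Finset.single_le_sum (f := fun j =>
      PowerSeries.truncNorm (Polynomial.l1Norm R) S₀ N (u j))
      (fun j _ => (hN.truncNorm hS₀0.le N).nonneg _) (Finset.mem_univ i))
    exact Finset.single_le_sum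
      (f := fun n => (PowerSeries.coeff n (u i)).l1Norm R * S₀ ^ n)
      (fun n _ => mul_nonneg (hN.nonneg _) (pow_nonneg hS₀0.le n)) (Finset.self_mem_range_succ N)
  have h2 : (PowerSeries.coeff N (u i)).l1Norm R * S₀ ^ N ≤ 1 := by linarith
  rw [hS₀, inv_pow, ← div_eq_mul_inv, div_le_one (pow_pos hD N)] at h2
  exact h2

/-- The degree of the coefficients in `log T` grows at most linearly, and their norms
geometrically. -/
theorem l1Norm_coeff_le (h : IsBriotBouquetSolution Φ u) :
    ∃ (K : ℕ) (B R₀ : ℝ), 1 ≤ B ∧ 1 ≤ R₀ ∧ ∀ R, R₀ ≤ R → ∀ i n,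
      (PowerSeries.coeff n (u i)).l1Norm R ≤ (B * R ^ K) ^ n := by
  obtain ⟨K, B, hB, hbound⟩ := h.l1Norm_coeff_le_of_natDegree_le
  -- For fixed `N`, every large `R` meets the degree hypothesis up to `N`. The resulting bound is of
  -- size `R ^ (K N)` as `R → ∞`, which limits the degree.
  have hdeg : ∀ i n, (PowerSeries.coeff n (u i)).natDegree ≤ K * n := by
    intro i N
    set D : ℕ := ∑ j, ∑ n ∈ Finset.range (N + 1), (PowerSeries.coeff n (u j)).natDegree with hD
    refine Polynomial.natDegree_le_of_l1Norm_le (B := B ^ N) (R₀ := 1 + 2 * D) fun R hR => ?_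
    have hD0 : (0 : ℝ) ≤ D := Nat.cast_nonneg D
    refine (hbound R (by linarith) N (fun j n hn => ?_) i).trans (le_of_eq ?_)
    · rcases Nat.eq_zero_or_pos n with rfl | hn0
      · rw [h.coeff_zero j]
        simp
      · have h1 : (PowerSeries.coeff n (u j)).natDegree ≤ D := by
          refine le_trans ?_ (Finset.single_le_sum (fun j _ => Nat.zero_le _) (Finset.mem_univ j))
          exact Finset.single_le_sum
            (f := fun n => (PowerSeries.coeff n (u j)).natDegree) (fun j _ => Nat.zero_le _)
            (Finset.mem_range_succ_iff.mpr hn)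
        have h2 : ((PowerSeries.coeff n (u j)).natDegree : ℝ) ≤ D := by exact_mod_cast h1
        have h3 : (1 : ℝ) ≤ n := by exact_mod_cast hn0
        nlinarith
    · rw [mul_pow, ← pow_mul]
  -- With degrees at most `K n`, the hypothesis holds for all `n` at once as soon as `R ≥ 2 K`.
  refine ⟨K, B, 1 + 2 * K, hB, by linarith [Nat.cast_nonneg (α := ℝ) K], fun R hR i N => ?_⟩
  have hK0 : (0 : ℝ) ≤ K := Nat.cast_nonneg K
  refine hbound R (by linarith) N (fun j n _ => ?_) i
  have h1 : ((PowerSeries.coeff n (u j)).natDegree : ℝ) ≤ K * n := by exact_mod_cast hdeg j n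
  have h2 : (0 : ℝ) ≤ n := Nat.cast_nonneg n
  nlinarith

end IsBriotBouquetSolution

/-! ### Reduction to a Briot-Bouquet system -/

theorem SysPoly.subst_single_ofPowerSeries {m : ℕ} (P : SysPoly m)
    (u : Fin m → PowerSeries ℂ[X]) :
    P.subst (fun j => HahnSeries.ofPowerSeries ℤ ℂ[X] (u j)) (HahnSeries.single 1 1)
      = HahnSeries.ofPowerSeries ℤ ℂ[X] (P.substPowerSeries u) := by
  rw [SysPoly.substPowerSeries, ← SysPoly.subst_ofPowerSeries, HahnSeries.ofPowerSeries_X]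

/-- If `T^{p_j} x_j` and `z` lie in a subring that contains `T` and the constants, then so does
`T^q P(x, z)`, provided that `q` is at least the weight of `P`. -/
theorem SysPoly.single_pow_mul_subst_mem {m : ℕ} {p : Fin m → ℕ} {r q : ℕ} {P : SysPoly m}
    (hP : ∀ d ∈ P.support, monomialWeight p r d ≤ q) {A : Subring LogLaurent}
    (hconst : ∀ c, LogLaurent.const c ∈ A) (hT : HahnSeries.single 1 1 ∈ A)
    {x : Fin m → LogLaurent} (hx : ∀ j, HahnSeries.single 1 1 ^ p j * x j ∈ A)
    {z : LogLaurent} (hz : z ∈ A) : HahnSeries.single 1 1 ^ q * P.subst x z ∈ A := by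
  rw [SysPoly.subst, MvPolynomial.eval₂_eq', Finset.mul_sum]
  refine Subring.sum_mem _ fun d hd => ?_
  have hdq : ∑ j, p j * d (some j) ≤ q := (Nat.le_add_left _ _).trans (hP d hd)
  -- Each `x_j` takes up `p_j` factors `T`, and `z` takes none; the weight bound makes the natural
  -- subtraction in the leftover exponent a true one.
  have h1 : (HahnSeries.single 1 1 : LogLaurent) ^ q *
      (LogLaurent.const (P.coeff d) * ∏ o, (o.elim z x) ^ d o) =
      LogLaurent.const (P.coeff d) * HahnSeries.single 1 1 ^ (q - ∑ j, p j * d (some j)) *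
        (z ^ d none * ∏ j, (HahnSeries.single 1 1 ^ p j * x j) ^ d (some j)) := by
    simp only [Fintype.prod_option, Option.elim_none, Option.elim_some, mul_pow,
      Finset.prod_mul_distrib, ← pow_mul, Finset.prod_pow_eq_pow_sum]
    rw [← Nat.sub_add_cancel hdq, pow_add, Nat.add_sub_cancel]
    ring
  rw [h1]
  exact A.mul_mem (A.mul_mem (hconst _) (A.pow_mem hT _)) (A.mul_mem (A.pow_mem hz _)
    (A.prod_mem fun j _ => A.pow_mem (hx j) _))

/-- The part of higher order of a series with leading term `c T^{-k}`, multiplied by `T^k`. -/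
def LogLaurent.tail (x : LogLaurent) (k : ℕ) : PowerSeries ℂ[X] :=
  PowerSeries.mk fun n => if n = 0 then 0 else x.coeff ((n : ℤ) - k)

theorem LogLaurent.coeff_tail (x : LogLaurent) (k n : ℕ) :
    PowerSeries.coeff n (x.tail k) = if n = 0 then 0 else x.coeff ((n : ℤ) - k) :=
  PowerSeries.coeff_mk _ _

theorem LogLaurent.coeff_single_pow_mul (x : LogLaurent) (k : ℕ) (n : ℤ) :
    (HahnSeries.single 1 1 ^ k * x).coeff n = x.coeff (n - k) := by
  rw [HahnSeries.single_pow, one_pow, HahnSeries.coeff_single_mul, one_mul]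
  simp

theorem HasLeadingForm.single_pow_mul {m : ℕ} {p : Fin m → ℕ} {c : Fin m → ℂ}
    {x : Fin m → LogLaurent} (h : HasLeadingForm p c x) (i : Fin m) :
    HahnSeries.single 1 1 ^ p i * x i
      = LogLaurent.const (c i) + HahnSeries.ofPowerSeries ℤ ℂ[X] ((x i).tail (p i)) := by
  rw [LogLaurent.const_eq_ofPowerSeries, ← map_add]
  ext1
  funext n
  rw [LogLaurent.coeff_single_pow_mul]
  rcases lt_or_ge n 0 with hn | hn
  · rw [PowerSeries.coeff_coe, if_pos hn, (h i).1 _ (by omega)]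
  · lift n to ℕ using hn
    rw [LaurentSeries.coeff_coe_powerSeries, map_add, PowerSeries.coeff_C,
      LogLaurent.coeff_tail]
    split_ifs with h0
    · subst h0
      rw [add_zero, ← (h i).2]
      congr 1
      simp
    · rw [zero_add]

/-- From `T^{p_i} x_i = c_i + u_i` follows `T u_i' = T^{p_i+1} x_i' + p_i T^{p_i} x_i`. By the
weight bounds the right-hand side is a polynomial in `u` and `T`, so it lies in the range of the
substitution map `ρ`; a preimage serves as `Φ_i`. -/
theorem HasLeadingForm.exists_isBriotBouquetSolution {m : ℕ} {p : Fin m → ℕ} {r : ℕ}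
    {f g : Fin m → SysPoly m} (hA1 : QuasiHomogeneous p r f)
    (hA2 : SmallPerturbation p r g) {z₀ : ℂ}
    {x : Fin m → LogLaurent} (hsol : IsFormalSolution f g z₀ x) {c : Fin m → ℂ}
    (h : HasLeadingForm p c x) :
    ∃ Φ : Fin m → SysPoly m, IsBriotBouquetSolution Φ fun i => (x i).tail (p i) := by
  set u : Fin m → PowerSeries ℂ[X] := fun i => (x i).tail (p i) with hu
  set ρ : SysPoly m →+* LogLaurent := MvPolynomial.eval₂Hom LogLaurent.const
    (fun o => o.elim (HahnSeries.single 1 1) fun j => HahnSeries.ofPowerSeries ℤ ℂ[X] (u j))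
    with hρ
  have hρu : ∀ P, ρ P = HahnSeries.ofPowerSeries ℤ ℂ[X] (SysPoly.substPowerSeries P u) :=
    fun P => P.subst_single_ofPowerSeries u
  have hconst : ∀ a, LogLaurent.const a ∈ ρ.range := fun a =>
    ⟨MvPolynomial.C a, MvPolynomial.eval₂_C ..⟩
  have hT : HahnSeries.single 1 1 ∈ ρ.range :=
    ⟨MvPolynomial.X none, MvPolynomial.eval₂_X ..⟩
  have hz : LogLaurent.indep z₀ ∈ ρ.range := Subring.add_mem _ (hconst z₀) hT
  have hx : ∀ j, HahnSeries.single 1 1 ^ p j * x j ∈ ρ.range := fun j => by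
    rw [h.single_pow_mul j]
    exact Subring.add_mem _ (hconst _) ⟨MvPolynomial.X (some j), MvPolynomial.eval₂_X ..⟩
  have hmem : ∀ i, HahnSeries.single 1 1 ^ (p i + 1) * (x i).deriv
      + LogLaurent.const (p i) * (HahnSeries.single 1 1 ^ p i * x i) ∈ ρ.range := by
    intro i
    rw [hsol i, mul_add]
    refine Subring.add_mem _ (Subring.add_mem _ ?_ ?_) (Subring.mul_mem _ (hconst _) (hx i))
    · exact SysPoly.single_pow_mul_subst_mem (fun d hd => (hA1.weight_eq i hd).le) hconst hT hx hz
    · exact SysPoly.single_pow_mul_subst_mem (fun d hd => (hA2.weight_lt i hd).le) hconst hT hx hz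
  choose Φ hΦ using hmem
  refine ⟨Φ, fun i => ?_, fun i n => ?_⟩
  · simp only [hu, LogLaurent.coeff_tail, if_true]
  · have h1 := congrArg (fun y : LogLaurent => y.coeff n) (hΦ i)
    simp only [hρu] at h1
    rw [LaurentSeries.coeff_coe_powerSeries, HahnSeries.coeff_add,
      LogLaurent.coeff_single_pow_mul, LogLaurent.const, RingHom.comp_apply,
      HahnSeries.C_apply, HahnSeries.coeff_single_zero_mul, LogLaurent.coeff_single_pow_mul,
      LogLaurent.coeff_deriv] at h1
    have h2 : (n : ℤ) - ((p i + 1 : ℕ) : ℤ) + 1 = (n : ℤ) - p i := by push_cast; ring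
    rw [h2] at h1
    refine Eq.trans ?_ h1.symm
    simp only [hu, LogLaurent.coeff_tail]
    -- In order `0` the contributions `-p_i c_i` and `p_i c_i` cancel, in accordance with the tail
    -- having no constant term.
    split_ifs with h0
    · subst h0
      rw [show ((0 : ℕ) : ℤ) - p i = -(p i : ℤ) by simp, (h i).2]
      simp
    · rw [zsmul_eq_mul]
      push_cast
      simp only [map_natCast]
      ring

/-! ### Convergence -/

/-- With `s = a - log t` the product equals `B e^a s^K e^{-s}`, which tends to `0` as `t → 0⁺`. -/
theorem exists_radius (a B : ℝ) (K : ℕ) :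
    ∃ ε : ℝ, 0 < ε ∧ ε ≤ 1 ∧ ∀ t, 0 < t → t < ε → B * (a - Real.log t) ^ K * t < 1 := by
  have h1 : Filter.Tendsto (fun t => a - Real.log t) (nhdsWithin 0 (Set.Ioi 0)) Filter.atTop :=
    Filter.tendsto_atTop_add_const_left _ a
      (Filter.tendsto_neg_atBot_atTop.comp Real.tendsto_log_nhdsGT_zero)
  have h2 := ((Real.tendsto_pow_mul_exp_neg_atTop_nhds_zero K).comp h1).const_mul (B * Real.exp a)
  rw [mul_zero] at h2
  obtain ⟨ε, hε, hsub⟩ := mem_nhdsGT_iff_exists_Ioo_subset.mp (h2.eventually_lt_const one_pos)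
  refine ⟨min ε 1, lt_min hε one_pos, min_le_right _ _, fun t ht hlt => ?_⟩
  have h3 := hsub ⟨ht, hlt.trans_le (min_le_left _ _)⟩
  simp only [Set.mem_ofPred_eq, Function.comp_apply] at h3
  rw [neg_sub, Real.exp_sub, Real.exp_log ht] at h3
  refine lt_of_eq_of_lt ?_ h3
  field_simp

theorem HasLeadingForm.converges {m : ℕ} {p : Fin m → ℕ} {r : ℕ}
    {f g : Fin m → SysPoly m} (hA1 : QuasiHomogeneous p r f)
    (hA2 : SmallPerturbation p r g) {z₀ : ℂ}
    {x : Fin m → LogLaurent} (hsol : IsFormalSolution f g z₀ x) {c : Fin m → ℂ}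
    (h : HasLeadingForm p c x) (i : Fin m) : (x i).Converges z₀ := by
  obtain ⟨Φ, hΦ⟩ := h.exists_isBriotBouquetSolution hA1 hA2 hsol
  obtain ⟨K, B, R₀, hB, hR₀, hbound⟩ := hΦ.l1Norm_coeff_le
  intro θ
  obtain ⟨ε, hε, hε1, hrad⟩ := exists_radius (R₀ + |θ|) B K
  refine ⟨ε, hε, fun z hz0 hz w hw hθ => ?_⟩
  set t := ‖z - z₀‖ with ht
  have hlog : Real.log t = w.re := by rw [ht, ← hw, Complex.norm_exp, Real.log_exp]
  have hlog0 : Real.log t ≤ 0 := Real.log_nonpos hz0.le (hz.le.trans hε1)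
  -- The norm is adapted to the point: this `R` is at least `R₀` and bounds `|w|`, because `Re w =
  -- log t ≤ 0` and `|Im w| ≤ θ`.
  set R := R₀ + |θ| - Real.log t with hR
  have hRR₀ : R₀ ≤ R := by linarith [abs_nonneg θ]
  have hwR : ‖w‖ ≤ R := by
    have h1 := Complex.norm_le_abs_re_add_abs_im w
    rw [← hlog, abs_of_nonpos hlog0] at h1
    linarith [le_abs_self θ]
  have hq0 : 0 ≤ B * R ^ K * t := by
    have : 0 ≤ R := by linarith
    positivity
  have hq1 : B * R ^ K * t < 1 := hrad t hz0 hz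
  have hne : z - z₀ ≠ 0 := norm_pos_iff.mp hz0
  have hinj : Function.Injective fun n : ℕ => (n : ℤ) - p i := fun a b hab => by
    simpa using hab
  rw [← hinj.summable_iff]
  · refine Summable.of_norm_bounded
      (g := fun n : ℕ => ((1 + ‖c i‖) * t ^ (-(p i : ℤ))) * (B * R ^ K * t) ^ n)
      ((summable_geometric_of_lt_one hq0 hq1).mul_left _) fun n => ?_
    -- The factor `1 + ‖c i‖` also covers `n = 0`, where the coefficient is `c i` and not that of
    -- the tail.
    have hcoeff : ‖((x i).coeff ((n : ℤ) - p i)).eval w‖ ≤ (1 + ‖c i‖) * (B * R ^ K) ^ n := by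
      rcases Nat.eq_zero_or_pos n with rfl | hn
      · rw [Nat.cast_zero, zero_sub, (h i).2, Polynomial.eval_C, pow_zero, mul_one]
        linarith
      · have h1 := hbound R hRR₀ i n
        rw [LogLaurent.coeff_tail, if_neg hn.ne'] at h1
        refine ((Polynomial.norm_eval_le_l1Norm hwR _).trans h1).trans ?_
        refine le_mul_of_one_le_left (pow_nonneg ?_ n) (by linarith [norm_nonneg (c i)])
        exact mul_nonneg (by linarith) (pow_nonneg (by linarith) K)
    rw [Function.comp_apply, norm_mul, norm_zpow, ← ht, sub_eq_add_neg (n : ℤ),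
      zpow_add₀ hz0.ne', zpow_natCast, ← sub_eq_add_neg]
    calc _ ≤ (1 + ‖c i‖) * (B * R ^ K) ^ n * (t ^ n * t ^ (-(p i : ℤ))) := by gcongr
      _ = _ := by rw [mul_pow (B * R ^ K)]; ring
  · intro n hn
    rw [(h i).1 n, Polynomial.eval_zero, zero_mul]
    by_contra hlt
    exact hn ⟨(n + p i).toNat, by simp only; omega⟩

end

theorem theorem2p9 {m : ℕ} (p : Fin m → ℕ) (r : ℕ) (f g : Fin m → SysPoly m)
    (hw : AdmissibleWeight p r f)
    (hA1 : QuasiHomogeneous p r f)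
    (hA2 : SmallPerturbation p r g)
    (hS : OnlyTrivialFixedPoint f)
    (z₀ : ℂ) (x : Fin m → LogLaurent)
    (hsol : IsFormalSolution f g z₀ x)
    (hsing : IsSingular x) :
    (∃ c : Fin m → ℂ, c ≠ 0 ∧ HasLeadingForm p c x) ∧ ∀ i, (x i).Converges z₀ := by
  obtain ⟨c, hc, h⟩ := exists_hasLeadingForm hw hA1 hA2 hS hsol hsing
  exact ⟨⟨c, hc, h⟩, fun i => h.converges hA1 hA2 hsol i⟩
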